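/- **Setting (adversarial heavy-tailed linear bandit).** Let $\varepsilon\in(1,2]$, $\sigma>0$, let $T$ be the number of rounds, let $\mathcal A$ be a finite set of $K\ge 1$ arms with feature vectors $\{\phi_a\}_{a\in\mathcal A}$ spanning $\mathbb R^d$, and let $\mathcal P(\mathcal A)$ be the set of probability distributions over $\mathcal A$. In each round $t=1,\dots,T$ a non-oblivious adversary chooses, depending on its internal randomization and on the past (the arms played and the losses observed in rounds $1,\dots,t-1$), a vector $\theta_t\in\mathbb R^d$ and distributions $\nu_{t,a}$ on $\mathbb R$ with $\mathbb E_{\ell\sim\nu_{t,a}}[\ell]=\langle\phi_a,\theta_t\rangle$ and $\mathbb E_{\ell\sim\nu_{t,a}}[|\ell|^{\varepsilon}]\le\sigma$ for all $a\in\mathcal A$. Given this past and the adversary's choices, the learner draws an arm $a_t\sim p_t$, independently of the loss $\ell_{t,a}\sim\nu_{t,a}$ for each $a$, and observes $\ell_{t,a_t}$. The regret is $$\operatorname{Reg}_T=\max_{a\in\mathcal A}\mathbb E\Big[\sum_{t=1}^T\ell_{t,a_t}-\sum_{t=1}^T\ell_{t,a}\Big].$$ **Algorithm.** Put $$\psi(q)=\sum_{a\in\mathcal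 A}q_a\log q_a,\qquad \beta=\Big(\frac{\log K}{\sigma d^{\varepsilon/2}T}\Big)^{-1/\varepsilon},\qquad \gamma=4\sigma^{2/\varepsilon}d\,\beta^{-2},\qquad s=\beta/2,$$ and let $p_0$ be a G-optimal design, i.e. a minimizer of $\max_{a}\phi_a^\top V(\pi)^{-1}\phi_a$ over all $\pi\in\mathcal P(\mathcal A)$ with $V(\pi)=\sum_{a}\pi_a\phi_a\phi_a^\top$ nonsingular. In round $t$ compute $$q_t\in\operatorname*{argmin}_{q\in\mathcal P(\mathcal A)}\Big\langle\sum_{r=1}^{t-1}(\hat\ell_r-b_r),\,q\Big\rangle+\beta\psi(q),\qquad p_t=(1-\gamma)q_t+\gamma p_0,$$ draw $a_t\sim p_t$, observe $\ell_{t,a_t}$, and, with $S_t=\sum_{a}p_{t,a}\phi_a\phi_a^\top$, set for all $a\in\mathcal A$ $$\tilde\ell_{t,a}=\phi_a^\top S_t^{-1}\phi_{a_t}\ell_{t,a_t},\qquad \hat\ell_{t,a}=\tilde\ell_{t,a}\mathbf 1\{|\tilde\ell_{t,a}|\le s\},\qquad b_{t,a}=\sigma s^{1-\varepsilon}\big(\phi_a^\top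 S_t^{-1}\phi_a\big)^{\varepsilon/2}.$$ The algorithm is run with parameters for which the $p_t$ are probability distributions, as is always the case if $\gamma\le1$, that is, if $T\ge 2^{\varepsilon}\log K$. (In the degenerate cases $K=1$ or $d=0$, where $\beta$ is not defined by the formula, $\beta$, $\gamma$, $s$ and $b_{t,a}$ are taken to be $0$; the regret is then $0$.) **Theorem.** There is an absolute constant $C>0$, independent of $T$, $K$, $d$, $\varepsilon$, $\sigma$, the features and the adversary, such that for every such adversarial heavy-tailed linear bandit the algorithm achieves $$\operatorname{Reg}_T\le C\,\sigma^{1/\varepsilon}(\log K)^{1-1/\varepsilon}\,d^{1/2}\,T^{1/\varepsilon}.$$ -/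

import Mathlib

open MeasureTheory Matrix

noncomputable section

namespace HeavyTailedLinearBandit

/-! Arms are indexed by `Fin K`, with feature vectors `φ : Fin K → (Fin d → ℝ)`; the rounds
`1, …, T` are numbered `0, …, T - 1`. -/

/-- The feature covariance matrix `∑ b, p b • φ_b φ_bᵀ`. -/
def covMatrix {K d : ℕ} (φ : Fin K → Fin d → ℝ) (p : Fin K → ℝ) : Matrix (Fin d) (Fin d) ℝ :=
  ∑ b, p b • vecMulVec (φ b) (φ b)

/-- `φ_bᵀ S⁻¹ φ_c`, where `S` is the covariance matrix of `p`. -/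
def invCovForm {K d : ℕ} (φ : Fin K → Fin d → ℝ) (p : Fin K → ℝ) (b c : Fin K) : ℝ :=
  φ b ⬝ᵥ ((covMatrix φ p)⁻¹ *ᵥ φ c)

/-- `π` is a G-optimal design: among all distributions over the arms with nonsingular
covariance matrix it minimizes `max_b φ_bᵀ S(π)⁻¹ φ_b`. -/
structure IsGOptimalDesign {K d : ℕ} (φ : Fin K → Fin d → ℝ) (π : Fin K → ℝ) : Prop where
  mem : π ∈ stdSimplex ℝ (Fin K)
  nonsing : IsUnit (covMatrix φ π).det
  optimal : ∀ π' ∈ stdSimplex ℝ (Fin K), IsUnit (covMatrix φ π').det →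
    (⨆ b, invCovForm φ π b b) ≤ ⨆ b, invCovForm φ π' b b

/-- Negative Shannon entropy. -/
def negEntropy {K : ℕ} (q : Fin K → ℝ) : ℝ := ∑ b, q b * Real.log (q b)

/-- `q` minimizes `⟨L, q⟩ + β ψ(q)` over the simplex, `ψ` being the negative Shannon entropy. -/
def IsFTRLPoint {K : ℕ} (β : ℝ) (L q : Fin K → ℝ) : Prop :=
  q ∈ stdSimplex ℝ (Fin K) ∧
    ∀ q' ∈ stdSimplex ℝ (Fin K), L ⬝ᵥ q + β * negEntropy q ≤ L ⬝ᵥ q' + β * negEntropy q'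

/-- The inverse learning rate `β`. -/
def invRate (K d T : ℕ) (ε σ : ℝ) : ℝ :=
  (Real.log K / (σ * (d : ℝ) ^ (ε / 2) * T)) ^ (-(1 / ε))

/-- The exploration strength `γ`. -/
def explRate (K d T : ℕ) (ε σ : ℝ) : ℝ :=
  4 * σ ^ (2 / ε) * d / invRate K d T ε σ ^ 2

/-- The clipping threshold `s`. -/
def clipLevel (K d T : ℕ) (ε σ : ℝ) : ℝ := invRate K d T ε σ / 2

/-- The mixture `(1 - γ) q + γ p₀`. -/
def mix {K : ℕ} (γ : ℝ) (p₀ q : Fin K → ℝ) : Fin K → ℝ :=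
  fun b => (1 - γ) * q b + γ * p₀ b

/-- The least-squares estimate of the loss of arm `b`, when arm `c`, drawn from `p`, incurred
the loss `x`. -/
def lossEst {K d : ℕ} (φ : Fin K → Fin d → ℝ) (p : Fin K → ℝ) (c : Fin K) (x : ℝ)
    (b : Fin K) : ℝ :=
  invCovForm φ p b c * x

/-- The clipped least-squares estimate. -/
def clippedEst {K d : ℕ} (s : ℝ) (φ : Fin K → Fin d → ℝ) (p : Fin K → ℝ) (c : Fin K) (x : ℝ)
    (b : Fin K) : ℝ :=
  if |lossEst φ p c x b| ≤ s then lossEst φ p c x b else 0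

/-- The bonus of arm `b`. -/
def bonus {K d : ℕ} (ε σ s : ℝ) (φ : Fin K → Fin d → ℝ) (p : Fin K → ℝ) (b : Fin K) : ℝ :=
  σ * s ^ (1 - ε) * invCovForm φ p b b ^ (ε / 2)

/-- The interaction between a learner and a non-oblivious adversary over `T` rounds.
`𝒢 t` contains everything that is determined before round `t`: the adversary's internal
randomization, the past arms and the past observed losses.  In round `t` the adversary chooses
`θ t` and the loss distributions `ν t b` depending on `𝒢 t`, with `ν t b` of mean `⟨φ_b, θ t⟩`.
Given `𝒢 t`, the arm is drawn from `p t`, independently of the loss `ℓ t b ∼ ν t b`;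
in particular `p t` is almost surely a probability vector. -/
structure IsAdversarialInteraction {Ω : Type*} [mΩ : MeasurableSpace Ω] {K d : ℕ}
    (μ : Measure Ω) (𝒢 : Filtration ℕ mΩ) (T : ℕ) (φ : Fin K → Fin d → ℝ)
    (θ : ℕ → Ω → Fin d → ℝ) (ν : ℕ → Fin K → Ω → Measure ℝ) (ℓ : ℕ → Fin K → Ω → ℝ)
    (p : ℕ → Ω → Fin K → ℝ) (arm : ℕ → Ω → Fin K) : Prop where
  theta_meas : ∀ t < T, Measurable[𝒢 t] (θ t)
  law_prob : ∀ t < T, ∀ b ω, IsProbabilityMeasure (ν t b ω)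
  law_meas : ∀ t < T, ∀ b (B : Set ℝ), MeasurableSet B → Measurable[𝒢 t] fun ω => ν t b ω B
  law_integrable : ∀ t < T, ∀ b ω, Integrable (fun x : ℝ => x) (ν t b ω)
  law_mean : ∀ t < T, ∀ b ω, ∫ x, x ∂(ν t b ω) = φ b ⬝ᵥ θ t ω
  loss_meas : ∀ t < T, ∀ b, Measurable (ℓ t b)
  arm_meas : ∀ t < T, Measurable[𝒢 (t + 1)] (arm t)
  observed_meas : ∀ t < T, Measurable[𝒢 (t + 1)] fun ω => ℓ t (arm t ω) ω
  joint_law : ∀ t < T, ∀ (b c : Fin K) (G : Set Ω) (B : Set ℝ),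
    MeasurableSet[𝒢 t] G → MeasurableSet B →
      μ (G ∩ {ω | arm t ω = c} ∩ {ω | ℓ t b ω ∈ B}) =
        ∫⁻ ω in G, ENNReal.ofReal (p t ω c) * ν t b ω B ∂μ

/-- All loss distributions have `ε`-th raw moment at most `σ`. -/
def IsHeavyTailed {Ω : Type*} {K : ℕ} (T : ℕ) (ε σ : ℝ) (ν : ℕ → Fin K → Ω → Measure ℝ) : Prop :=
  ∀ t < T, ∀ b ω, ∫⁻ x, ENNReal.ofReal (|x| ^ ε) ∂(ν t b ω) ≤ ENNReal.ofReal σ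

/-- The FTRL iterates `q` of the algorithm, on the played arms `arm` and the losses `ℓ`: `q t`
is computed from the clipped estimates and bonuses of the rounds before `t`, where in round `s`
the sampling distribution is `mix γ p₀ (q s)`. -/
structure IsFTRLRun {Ω : Type*} [mΩ : MeasurableSpace Ω] {K d : ℕ}
    (𝒢 : Filtration ℕ mΩ) (T : ℕ) (ε σ : ℝ) (φ : Fin K → Fin d → ℝ) (p₀ : Fin K → ℝ)
    (ℓ : ℕ → Fin K → Ω → ℝ) (arm : ℕ → Ω → Fin K) (q : ℕ → Ω → Fin K → ℝ) : Prop where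
  meas : ∀ t < T, Measurable[𝒢 t] (q t)
  argmin : ∀ t < T, ∀ ω, IsFTRLPoint (invRate K d T ε σ)
    (fun b => ∑ s ∈ Finset.range t,
      (clippedEst (clipLevel K d T ε σ) φ (mix (explRate K d T ε σ) p₀ (q s ω))
          (arm s ω) (ℓ s (arm s ω) ω) b
        - bonus ε σ (clipLevel K d T ε σ) φ (mix (explRate K d T ε σ) p₀ (q s ω)) b))
    (q t ω)

/-- The pseudo-regret `max_b E[∑ t, ℓ_{t, a_t} - ∑ t, ℓ_{t, b}]`. -/
def pseudoRegret {Ω : Type*} [MeasurableSpace Ω] {K : ℕ} (μ : Measure Ω) (T : ℕ)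
    (ℓ : ℕ → Fin K → Ω → ℝ) (arm : ℕ → Ω → Fin K) : ℝ :=
  ⨆ b : Fin K, ∫ ω, (∑ t ∈ Finset.range T, ℓ t (arm t ω) ω - ∑ t ∈ Finset.range T, ℓ t b ω) ∂μ

end HeavyTailedLinearBandit

end

noncomputable section

namespace HeavyTailedLinearBandit

/-! ### Covariance matrices and the least-squares estimator. -/

section LinearAlgebra

variable {K d : ℕ} (φ : Fin K → Fin d → ℝ)

/-! Write γ for the exploration rate, β for the inverse learning rate, s = β / 2, and S for the
covariance matrix of the sampling distribution p. Suppose first that γ ≤ 1/2. Passing from p to the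
FTRL point q costs at most 4γσ^{1/ε} per round, since all mean losses are at most 2σ^{1/ε} in
absolute value. It remains to bound the regret of q.

Unclipped least-squares estimates are unbiased but heavy-tailed. Clipping at s creates a bias of at
most s^{1-ε} times the conditional ε-th moment of the estimate, and the second moment of the clipped
estimate is at most s^{2-ε} times the same moment. By Jensen over the sampled arm, σ s^{1-ε} Σ_c p_c
|φ_bᵀ S⁻¹ φ_c|^ε is at most the bonus of b (`sum_moment_le_bonus`), so the bonus controls both bias
and stability. Subtracting it from the estimate cancels the bias at the comparator, whose bonus is
otherwise uncontrolled. What is left is four times the q-average of the bonuses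
(`regret_le_integral_stableRegret`).

FTRL with negative entropy is exponential weights, with regret β log K plus a second-order term,
provided the losses fed to it are at most β in absolute value (`ftrl_regret_le`). The clipped
estimate is at most β / 2 by construction. The bonus is at most β / 2 because the Kiefer–Wolfowitz
bound and exploration give φ_bᵀ S⁻¹ φ_b ≤ d / γ, and γ is tuned to this (`bonus_le_clipLevel`). The
q-average of the bonuses is bounded by Jensen and the trace identity Σ p_b φ_bᵀ S⁻¹ φ_b = d; the
choice of β makes its sum over T rounds at most 4 β log K (`sum_mul_bonus_le`).

If γ > 1/2, then log K / T is so large that the trivial bound 4σ^{1/ε}T already has the right order.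
-/

lemma covMatrix_mulVec (p : Fin K → ℝ) (v : Fin d → ℝ) :
    covMatrix φ p *ᵥ v = ∑ c, (p c * (φ c ⬝ᵥ v)) • φ c := by
  simp only [covMatrix, sum_mulVec, smul_mulVec, vecMulVec_mulVec]
  refine Finset.sum_congr rfl fun c _ => ?_
  ext i
  simp
  ring

lemma dotProduct_covMatrix_mulVec (p : Fin K → ℝ) (u v : Fin d → ℝ) :
    u ⬝ᵥ (covMatrix φ p *ᵥ v) = ∑ c, p c * (φ c ⬝ᵥ u) * (φ c ⬝ᵥ v) := by
  rw [covMatrix_mulVec, dotProduct_sum]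
  refine Finset.sum_congr rfl fun c _ => ?_
  rw [dotProduct_smul, smul_eq_mul, dotProduct_comm u]
  ring

lemma covMatrix_transpose (p : Fin K → ℝ) : (covMatrix φ p)ᵀ = covMatrix φ p := by
  simp [covMatrix, transpose_sum, transpose_smul, transpose_vecMulVec]

lemma covMatrix_posSemidef {p : Fin K → ℝ} (hp : ∀ c, 0 ≤ p c) : (covMatrix φ p).PosSemidef := by
  refine posSemidef_sum _ fun c _ => ?_
  have h := posSemidef_vecMulVec_self_star (φ c)
  rw [star_trivial] at h
  exact h.smul (hp c)

lemma covMatrix_mix (γ : ℝ) (p₀ q : Fin K → ℝ) :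
    covMatrix φ (mix γ p₀ q) = (1 - γ) • covMatrix φ q + γ • covMatrix φ p₀ := by
  simp [covMatrix, mix, Finset.smul_sum, add_smul, mul_smul, Finset.sum_add_distrib]

lemma invCovForm_comm (p : Fin K → ℝ) (b c : Fin K) :
    invCovForm φ p b c = invCovForm φ p c b := by
  have h : ((covMatrix φ p)⁻¹)ᵀ = (covMatrix φ p)⁻¹ := by
    rw [transpose_nonsing_inv, covMatrix_transpose]
  unfold invCovForm
  rw [dotProduct_mulVec, ← mulVec_transpose, h, dotProduct_comm]

variable {φ} {p : Fin K → ℝ}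

/-- Unbiasedness of the least-squares estimator. -/
lemma sum_mul_invCovForm_mul_dotProduct (h : IsUnit (covMatrix φ p).det) (b : Fin K)
    (v : Fin d → ℝ) :
    ∑ c, p c * invCovForm φ p b c * (φ c ⬝ᵥ v) = φ b ⬝ᵥ v := by
  have h1 : v = (covMatrix φ p)⁻¹ *ᵥ (covMatrix φ p *ᵥ v) := by
    rw [mulVec_mulVec, nonsing_inv_mul _ h, one_mulVec]
  conv_rhs => rw [h1, covMatrix_mulVec, mulVec_sum, dotProduct_sum]
  refine Finset.sum_congr rfl fun c _ => ?_
  rw [mulVec_smul, dotProduct_smul, smul_eq_mul, invCovForm]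
  ring

lemma sum_mul_invCovForm_sq (h : IsUnit (covMatrix φ p).det) (b : Fin K) :
    ∑ c, p c * invCovForm φ p b c ^ 2 = invCovForm φ p b b := by
  -- Unbiasedness tested on the vector S⁻¹ φ_b.
  have := sum_mul_invCovForm_mul_dotProduct h b ((covMatrix φ p)⁻¹ *ᵥ φ b)
  rw [← invCovForm] at this
  rw [← this]
  refine Finset.sum_congr rfl fun c _ => ?_
  rw [← invCovForm, invCovForm_comm φ p c b]
  ring

lemma invCovForm_self_nonneg (hp : ∀ c, 0 ≤ p c) (h : IsUnit (covMatrix φ p).det) (b : Fin K) :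
    0 ≤ invCovForm φ p b b := by
  rw [← sum_mul_invCovForm_sq h]
  exact Finset.sum_nonneg fun c _ => mul_nonneg (hp c) (sq_nonneg _)

/-- This is the trace of S⁻¹ S = 1, expanded along the rank-one summands of S. -/
lemma sum_mul_invCovForm_self (h : IsUnit (covMatrix φ p).det) :
    ∑ b, p b * invCovForm φ p b b = d := by
  have h1 : ((covMatrix φ p)⁻¹ * covMatrix φ p).trace = d := by
    rw [nonsing_inv_mul _ h, trace_one, Fintype.card_fin]
  have h2 : (covMatrix φ p)⁻¹ * covMatrix φ p =
      ∑ c, (covMatrix φ p)⁻¹ * (p c • vecMulVec (φ c) (φ c)) := by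
    rw [← Finset.mul_sum, ← covMatrix]
  rw [← h1, h2, trace_sum]
  refine Finset.sum_congr rfl fun c _ => ?_
  rw [Algebra.mul_smul_comm, trace_smul, mul_vecMulVec, trace_vecMulVec, smul_eq_mul, invCovForm,
    dotProduct_comm]

/-- A kernel vector of the mixture's covariance is orthogonal to every feature charged by the
mixture, hence to every feature charged by p₀, so it lies in the kernel for p₀. -/
lemma isUnit_det_covMatrix_mix {γ : ℝ} {p₀ q : Fin K → ℝ} (hγ : 0 < γ) (hγ1 : γ ≤ 1)
    (hq : ∀ c, 0 ≤ q c) (hp₀ : ∀ c, 0 ≤ p₀ c) (h : IsUnit (covMatrix φ p₀).det) :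
    IsUnit (covMatrix φ (mix γ p₀ q)).det := by
  rw [isUnit_iff_ne_zero] at h ⊢
  intro h0
  obtain ⟨v, hv, hv0⟩ := exists_mulVec_eq_zero_iff.2 h0
  refine h (exists_mulVec_eq_zero_iff.1 ⟨v, hv, ?_⟩)
  have h1 : ∑ c, mix γ p₀ q c * (φ c ⬝ᵥ v) * (φ c ⬝ᵥ v) = 0 := by
    rw [← dotProduct_covMatrix_mulVec, hv0, dotProduct_zero]
  have hm : ∀ c, γ * p₀ c ≤ mix γ p₀ q c := fun c => by
    have := mul_nonneg (sub_nonneg.2 hγ1) (hq c)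
    simp only [mix]
    linarith
  have hm0 : ∀ c, 0 ≤ mix γ p₀ q c := fun c => (mul_nonneg hγ.le (hp₀ c)).trans (hm c)
  have h2 := (Finset.sum_eq_zero_iff_of_nonneg (fun c _ => by
    rw [mul_assoc]; exact mul_nonneg (hm0 c) (mul_self_nonneg _))).1 h1
  rw [covMatrix_mulVec]
  refine Finset.sum_eq_zero fun c hc => ?_
  rcases eq_or_ne (φ c ⬝ᵥ v) 0 with hz | hz
  · simp [hz]
  · have h3 : mix γ p₀ q c = 0 := by simpa [hz] using h2 c hc
    have h4 : p₀ c = 0 := by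
      have := hm c
      rw [h3] at this
      exact le_antisymm (nonpos_of_mul_nonpos_right this hγ) (hp₀ c)
    simp [h4]

/-- Exploring with `p₀` at rate `γ` keeps the variance proxy below that of `p₀` divided by `γ`. -/
lemma invCovForm_mix_self_le {γ : ℝ} {p₀ q : Fin K → ℝ} (hγ : 0 < γ) (hγ1 : γ ≤ 1)
    (hq : ∀ c, 0 ≤ q c) (hp₀ : ∀ c, 0 ≤ p₀ c) (h : IsUnit (covMatrix φ p₀).det) (b : Fin K) :
    invCovForm φ (mix γ p₀ q) b b ≤ invCovForm φ p₀ b b / γ := by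
  have hS := isUnit_det_covMatrix_mix hγ hγ1 hq hp₀ h
  set p := mix γ p₀ q with hp
  have hm : ∀ c, γ * p₀ c ≤ p c := fun c => by
    have := mul_nonneg (sub_nonneg.2 hγ1) (hq c)
    simp only [hp, mix]
    linarith
  have hm0 : ∀ c, 0 ≤ p c := fun c => (mul_nonneg hγ.le (hp₀ c)).trans (hm c)
  have hg := invCovForm_self_nonneg hm0 hS b
  have hg0 := invCovForm_self_nonneg hp₀ h b
  have h1 : γ * ∑ c, p₀ c * invCovForm φ p b c ^ 2 ≤ invCovForm φ p b b := by
    rw [← sum_mul_invCovForm_sq hS b, Finset.mul_sum]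
    refine Finset.sum_le_sum fun c _ => ?_
    rw [← mul_assoc]
    exact mul_le_mul_of_nonneg_right (hm c) (sq_nonneg _)
  have h2 : ∑ c, p₀ c * invCovForm φ p₀ b c * invCovForm φ p b c = invCovForm φ p b b := by
    have := sum_mul_invCovForm_mul_dotProduct h b ((covMatrix φ p)⁻¹ *ᵥ φ b)
    rw [← invCovForm] at this
    rw [← this]
    refine Finset.sum_congr rfl fun c _ => ?_
    rw [← invCovForm, invCovForm_comm φ p c b]
  -- Cauchy–Schwarz in L²(p₀) for the cross term `h2`. With `h1` it reads g² ≤ g₀ · g / γ, which is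
  -- divided by g at the end.
  have h3 : invCovForm φ p b b ^ 2 ≤
      invCovForm φ p₀ b b * ∑ c, p₀ c * invCovForm φ p b c ^ 2 := by
    rw [← h2, ← sum_mul_invCovForm_sq h b]
    have := Finset.sum_mul_sq_le_sq_mul_sq Finset.univ
      (fun c => √(p₀ c) * invCovForm φ p₀ b c) (fun c => √(p₀ c) * invCovForm φ p b c)
    simp only [mul_pow, Real.sq_sqrt (hp₀ _)] at this
    refine le_trans (le_of_eq ?_) this
    congr 1
    refine Finset.sum_congr rfl fun c _ => ?_
    linear_combination
      -(invCovForm φ p₀ b c * invCovForm φ p b c) * Real.mul_self_sqrt (hp₀ c)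
  rw [le_div_iff₀ hγ]
  rcases hg.eq_or_lt with hz | hpos
  · rw [← hz, zero_mul]; exact hg0
  · refine le_of_mul_le_mul_left ?_ hpos
    have := mul_le_mul_of_nonneg_left h1 hg0
    nlinarith

end LinearAlgebra

/-! ### Optimal designs. -/

section OptimalDesign

variable {K d : ℕ} {φ : Fin K → Fin d → ℝ}

/-- The matrix determinant lemma for a rank-one update; it evaluates the determinant along a segment
from a design to a point mass. -/
lemma det_smul_covMatrix_add_vecMulVec {p : Fin K → ℝ} (h : IsUnit (covMatrix φ p).det)
    {x y : ℝ} (hx : x ≠ 0) (b : Fin K) :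
    (x • covMatrix φ p + y • vecMulVec (φ b) (φ b)).det =
      x ^ d * (covMatrix φ p).det * (1 + y / x * invCovForm φ p b b) := by
  have h1 : x • covMatrix φ p + y • vecMulVec (φ b) (φ b) =
      x • (covMatrix φ p + replicateCol Unit ((y / x) • φ b) * replicateRow Unit (φ b)) := by
    rw [smul_add, ← vecMulVec_eq, smul_vecMulVec, smul_smul, mul_div_cancel₀ _ hx]
  rw [h1, det_smul, Fintype.card_fin, det_add_replicateCol_mul_replicateRow h, mul_assoc,
    Matrix.mul_assoc, ← replicateCol_mulVec,
    det_unique (1 + _ : Matrix Unit Unit ℝ)]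
  simp only [Matrix.add_apply, one_apply_eq, replicateRow_mul_replicateCol_apply, mulVec_smul,
    dotProduct_smul, smul_eq_mul]
  rfl

/-- A D-optimal design has variance proxy at most `d`. -/
lemma exists_design_invCovForm_self_le {p₀ : Fin K → ℝ} (hp₀ : p₀ ∈ stdSimplex ℝ (Fin K))
    (h₀ : IsUnit (covMatrix φ p₀).det) :
    ∃ π ∈ stdSimplex ℝ (Fin K), IsUnit (covMatrix φ π).det ∧ ∀ b, invCovForm φ π b b ≤ d := by
  have hcont : Continuous fun π : Fin K → ℝ => (covMatrix φ π).det := by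
    refine Continuous.matrix_det ?_
    unfold covMatrix
    fun_prop
  obtain ⟨π, hπ, hmax⟩ := (isCompact_stdSimplex ℝ (Fin K)).exists_isMaxOn ⟨p₀, hp₀⟩
    hcont.continuousOn
  have hpos : 0 < (covMatrix φ π).det :=
    ((covMatrix_posSemidef φ hp₀.1).det_nonneg.lt_of_ne (isUnit_iff_ne_zero.1 h₀).symm).trans_le
      (hmax hp₀)
  have hu : IsUnit (covMatrix φ π).det := isUnit_iff_ne_zero.2 hpos.ne'
  refine ⟨π, hπ, hu, fun b => ?_⟩
  set g := invCovForm φ π b b with hg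
  rcases Nat.eq_zero_or_pos d with rfl | hd
  · simp [hg, invCovForm]
  -- First-order optimality without derivatives: compare π with (1 - l) π + l δ_b, linearize by
  -- Bernoulli's inequality, and let l tend to 0.
  have key : ∀ l ∈ Set.Ioo (0 : ℝ) 1, g - d ≤ l * ((d - 1) * (g - 1)) := by
    rintro l ⟨hl0, hl1⟩
    have hx : (1 - l) ≠ 0 := by linarith
    have hmix : mix l (Pi.single b 1) π ∈ stdSimplex ℝ (Fin K) :=
      convex_stdSimplex ℝ (Fin K) hπ (single_mem_stdSimplex ℝ b)
        (by linarith) hl0.le (by ring)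
    have hle : (covMatrix φ (mix l (Pi.single b 1) π)).det ≤ (covMatrix φ π).det := hmax hmix
    have hs : covMatrix φ (Pi.single b 1) = vecMulVec (φ b) (φ b) := by
      unfold covMatrix
      rw [Finset.sum_eq_single b (fun c _ hc => by simp [hc]) (by simp)]
      simp
    rw [covMatrix_mix, hs, det_smul_covMatrix_add_vecMulVec hu hx] at hle
    have h1 : (1 - l) ^ d * (1 + l / (1 - l) * g) ≤ 1 := by
      refine le_of_mul_le_mul_right ?_ hpos
      linarith
    -- One of the d factors 1 - l cancels the denominator of l / (1 - l), leaving the power d - 1.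
    obtain ⟨n, rfl⟩ : ∃ n, d = n + 1 := ⟨d - 1, by omega⟩
    have h2 : (1 - l) ^ (n + 1) * (1 + l / (1 - l) * g) = (1 - l) ^ n * (1 + l * (g - 1)) := by
      field_simp
      ring
    rw [h2] at h1
    have hg0 : 0 ≤ g := invCovForm_self_nonneg hπ.1 hu b
    have h3 : 1 - n * l ≤ (1 - l) ^ n := by
      have := one_add_mul_le_pow (a := -l) (by linarith) n
      rw [sub_eq_add_neg 1 l]
      linarith
    have h4 : 0 ≤ 1 + l * (g - 1) := by nlinarith
    have h5 := (mul_le_mul_of_nonneg_right h3 h4).trans h1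
    push_cast
    refine le_of_mul_le_mul_left ?_ hl0
    nlinarith
  by_contra! hlt
  have hlim : Filter.Tendsto (fun l : ℝ => l * ((d - 1) * (g - 1))) (nhdsWithin 0 (Set.Ioi 0))
      (nhds 0) := by
    have : Continuous fun l : ℝ => l * ((d - 1) * (g - 1)) := by fun_prop
    simpa using (this.tendsto 0).mono_left nhdsWithin_le_nhds
  have hge := ge_of_tendsto hlim (Filter.eventually_of_mem
    (Ioo_mem_nhdsGT (zero_lt_one' ℝ)) key)
  linarith

/-- The Kiefer–Wolfowitz bound. -/
lemma IsGOptimalDesign.invCovForm_self_le {p₀ : Fin K → ℝ} (h : IsGOptimalDesign φ p₀)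
    (b : Fin K) : invCovForm φ p₀ b b ≤ d := by
  obtain ⟨π, hπ, hu, hle⟩ := exists_design_invCovForm_self_le h.mem h.nonsing
  have : Nonempty (Fin K) := ⟨b⟩
  exact ((le_ciSup (Set.finite_range fun b => invCovForm φ p₀ b b).bddAbove b).trans
    (h.optimal π hπ hu)).trans (ciSup_le hle)

end OptimalDesign

/-! ### FTRL with negative entropy as exponential weights. -/

section ExponentialWeights

variable {K : ℕ}

/-- The partition function of the exponential weights at cumulative loss `L`. -/
def partitionFun (β : ℝ) (L : Fin K → ℝ) : ℝ := ∑ b, Real.exp (-L b / β)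

/-- The exponential weights distribution at cumulative loss `L`. -/
def expWeights (β : ℝ) (L : Fin K → ℝ) (b : Fin K) : ℝ :=
  Real.exp (-L b / β) / partitionFun β L

lemma partitionFun_pos [Nonempty (Fin K)] (β : ℝ) (L : Fin K → ℝ) : 0 < partitionFun β L :=
  Finset.sum_pos (fun _ _ => Real.exp_pos _) Finset.univ_nonempty

lemma expWeights_pos [Nonempty (Fin K)] (β : ℝ) (L : Fin K → ℝ) (b : Fin K) :
    0 < expWeights β L b :=
  div_pos (Real.exp_pos _) (partitionFun_pos β L)

lemma expWeights_mem [Nonempty (Fin K)] (β : ℝ) (L : Fin K → ℝ) :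
    expWeights β L ∈ stdSimplex ℝ (Fin K) := by
  refine ⟨fun b => (expWeights_pos β L b).le, ?_⟩
  simp only [expWeights, ← Finset.sum_div]
  exact div_self (partitionFun_pos β L).ne'

/-- The Gibbs variational identity. -/
lemma dotProduct_add_negEntropy_eq [Nonempty (Fin K)] {β : ℝ} (hβ : β ≠ 0) (L : Fin K → ℝ)
    {q : Fin K → ℝ} (hq : q ∈ stdSimplex ℝ (Fin K)) :
    L ⬝ᵥ q + β * negEntropy q = -β * Real.log (partitionFun β L) +
      β * ∑ b, expWeights β L b * InformationTheory.klFun (q b / expWeights β L b) := by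
  have hZ := partitionFun_pos β L
  have hterm : ∀ b, expWeights β L b * InformationTheory.klFun (q b / expWeights β L b) =
      q b * Real.log (q b) + q b * (L b / β) + q b * Real.log (partitionFun β L)
        + (expWeights β L b - q b) := by
    intro b
    have hw := expWeights_pos β L b
    have hlog : Real.log (expWeights β L b) = -L b / β - Real.log (partitionFun β L) := by
      rw [expWeights, Real.log_div (Real.exp_pos _).ne' hZ.ne', Real.log_exp]
    rw [InformationTheory.klFun]
    rcases (hq.1 b).eq_or_lt with h0 | h0
    · simp [← h0]
    · rw [Real.log_div h0.ne' hw.ne', hlog]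
      field_simp
      ring
  simp only [hterm, Finset.sum_add_distrib, Finset.sum_sub_distrib, (expWeights_mem β L).2, hq.2,
    ← Finset.sum_mul, negEntropy, dotProduct]
  have : ∑ b, q b * (L b / β) = (∑ b, L b * q b) / β := by
    rw [Finset.sum_div]
    exact Finset.sum_congr rfl fun b _ => by ring
  rw [this]
  field_simp
  ring

/-- In the Gibbs identity only the relative entropy of q to the exponential weights depends on q.
Each summand is nonnegative and vanishes only when the two weights agree, so the minimizer is
unique. -/
lemma IsFTRLPoint.eq_expWeights {β : ℝ} (hβ : 0 < β) {L q : Fin K → ℝ}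
    (h : IsFTRLPoint β L q) [Nonempty (Fin K)] : q = expWeights β L := by
  have h1 := h.2 _ (expWeights_mem β L)
  rw [dotProduct_add_negEntropy_eq hβ.ne' L h.1,
    dotProduct_add_negEntropy_eq hβ.ne' L (expWeights_mem β L)] at h1
  have hw := expWeights_pos β L
  simp only [div_self (hw _).ne', InformationTheory.klFun_one, mul_zero, Finset.sum_const_zero,
    add_zero, add_le_iff_nonpos_right] at h1
  have hnn : ∀ b ∈ Finset.univ, 0 ≤
      expWeights β L b * InformationTheory.klFun (q b / expWeights β L b) := fun b _ =>
    mul_nonneg (hw b).le (InformationTheory.klFun_nonneg (div_nonneg (h.1.1 b) (hw b).le))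
  have h2 := le_antisymm (nonpos_of_mul_nonpos_right h1 hβ) (Finset.sum_nonneg hnn)
  funext b
  have h3 := (Finset.sum_eq_zero_iff_of_nonneg hnn).1 h2 b (Finset.mem_univ b)
  have h4 := (mul_eq_zero.1 h3).resolve_left (hw b).ne'
  rw [InformationTheory.klFun_eq_zero_iff (div_nonneg (h.1.1 b) (hw b).le)] at h4
  exact (div_eq_one_iff_eq (hw b).ne').1 h4

lemma exp_neg_le_one_sub_add_sq {y : ℝ} (hy : |y| ≤ 1) : Real.exp (-y) ≤ 1 - y + y ^ 2 := by
  have h := Real.abs_exp_sub_one_sub_id_le (x := -y) (by rwa [abs_neg])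
  have := (abs_le.1 h).2
  nlinarith

/-- One step of the potential `-β log Z` of exponential weights. -/
lemma potential_step [Nonempty (Fin K)] {β : ℝ} (hβ : 0 < β) (L x : Fin K → ℝ)
    (hx : ∀ b, |x b| ≤ β) :
    (∑ b, expWeights β L b * x b) - ∑ b, expWeights β L b * x b ^ 2 / β ≤
      -β * Real.log (partitionFun β (L + x)) - -β * Real.log (partitionFun β L) := by
  have hZ := partitionFun_pos β L
  have hw := expWeights_pos β L
  have h1 : partitionFun β (L + x) / partitionFun β L =
      ∑ b, expWeights β L b * Real.exp (-(x b / β)) := by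
    rw [partitionFun, Finset.sum_div]
    refine Finset.sum_congr rfl fun b _ => ?_
    rw [expWeights, div_mul_eq_mul_div, ← Real.exp_add]
    congr 2
    simp only [Pi.add_apply]
    ring
  -- The ratio of partition functions is an average of exp(-x/β); it is bounded using log z ≤ z - 1
  -- and then exp(-y) ≤ 1 - y + y², which needs |x| ≤ β.
  have h2 : Real.log (partitionFun β (L + x)) - Real.log (partitionFun β L) ≤
      partitionFun β (L + x) / partitionFun β L - 1 := by
    rw [← Real.log_div (partitionFun_pos β _).ne' hZ.ne']
    exact Real.log_le_sub_one_of_pos (div_pos (partitionFun_pos β _) hZ)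
  have h3 : ∑ b, expWeights β L b * Real.exp (-(x b / β)) ≤
      ∑ b, expWeights β L b * (1 - x b / β + (x b / β) ^ 2) := by
    refine Finset.sum_le_sum fun b _ => mul_le_mul_of_nonneg_left ?_ (hw b).le
    refine exp_neg_le_one_sub_add_sq ?_
    rw [abs_div, abs_of_pos hβ, div_le_one hβ]
    exact hx b
  have h4 : ∑ b, expWeights β L b * (1 - x b / β + (x b / β) ^ 2) =
      1 - ((∑ b, expWeights β L b * x b) - ∑ b, expWeights β L b * x b ^ 2 / β) / β := by
    rw [← Finset.sum_sub_distrib, Finset.sum_div]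
    nth_rewrite 2 [← (expWeights_mem β L).2]
    rw [← Finset.sum_sub_distrib]
    refine Finset.sum_congr rfl fun b _ => ?_
    field_simp
    ring
  rw [h1] at h2
  rw [h4] at h3
  have h5 : ((∑ b, expWeights β L b * x b) - ∑ b, expWeights β L b * x b ^ 2 / β) / β ≤
      Real.log (partitionFun β L) - Real.log (partitionFun β (L + x)) := by linarith
  rw [div_le_iff₀ hβ] at h5
  linarith

/-- The regret of follow-the-regularized-leader with negative entropy, for losses bounded by the
inverse learning rate. -/
lemma ftrl_regret_le [Nonempty (Fin K)] {β : ℝ} (hβ : 0 < β) (T : ℕ) (x q : ℕ → Fin K → ℝ)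
    (hx : ∀ t < T, ∀ b, |x t b| ≤ β)
    (hq : ∀ t < T, IsFTRLPoint β (fun b => ∑ s ∈ Finset.range t, x s b) (q t)) (a : Fin K) :
    ∑ t ∈ Finset.range T, ((∑ b, q t b * x t b) - x t a - ∑ b, q t b * x t b ^ 2 / β) ≤
      β * Real.log K := by
  set L : ℕ → Fin K → ℝ := fun t b => ∑ s ∈ Finset.range t, x s b with hL
  set Φ : ℕ → ℝ := fun t => -β * Real.log (partitionFun β (L t)) with hΦ
  have hstep : ∀ t ∈ Finset.range T,
      (∑ b, q t b * x t b) - x t a - ∑ b, q t b * x t b ^ 2 / β ≤ Φ (t + 1) - Φ t - x t a := by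
    intro t ht
    have ht' := Finset.mem_range.1 ht
    have hLs : L (t + 1) = L t + x t := by
      funext b
      simp [hL, Finset.sum_range_succ]
    have := potential_step hβ (L t) (x t) (hx t ht')
    rw [← (hq t ht').eq_expWeights hβ, ← hLs] at this
    simp only [hΦ]
    linarith
  refine (Finset.sum_le_sum hstep).trans ?_
  rw [Finset.sum_sub_distrib, Finset.sum_range_sub]
  have h0 : Φ 0 = -β * Real.log K := by
    simp [hΦ, hL, partitionFun]
  -- The final partition function is at least its single term at a; the initial one is K, which
  -- gives β log K after telescoping.
  have hT : Φ T ≤ L T a := by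
    have h1 : -L T a / β ≤ Real.log (partitionFun β (L T)) := by
      rw [Real.le_log_iff_exp_le (partitionFun_pos _ _)]
      exact Finset.single_le_sum (f := fun b => Real.exp (-L T b / β))
        (fun _ _ => (Real.exp_pos _).le) (Finset.mem_univ a)
    rw [div_le_iff₀ hβ] at h1
    simp only [hΦ]
    linarith
  rw [h0]
  simp only [hL] at hT
  linarith

end ExponentialWeights

/-! ### Truncation and moment inequalities. -/

section HeavyTails

variable {ε σ : ℝ} {ν : Measure ℝ}

lemma integrable_abs_rpow (h : ∫⁻ x, ENNReal.ofReal (|x| ^ ε) ∂ν ≤ ENNReal.ofReal σ) :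
    Integrable (fun x : ℝ => |x| ^ ε) ν := by
  refine ⟨(measurable_id.abs.pow_const ε).aestronglyMeasurable, ?_⟩
  rw [hasFiniteIntegral_iff_ofReal (Filter.Eventually.of_forall fun x => by positivity)]
  exact h.trans_lt ENNReal.ofReal_lt_top

lemma integral_abs_rpow_le (hσ : 0 ≤ σ)
    (h : ∫⁻ x, ENNReal.ofReal (|x| ^ ε) ∂ν ≤ ENNReal.ofReal σ) :
    ∫ x, |x| ^ ε ∂ν ≤ σ := by
  rw [integral_eq_lintegral_of_nonneg_ae (Filter.Eventually.of_forall fun x => by positivity)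
    (integrable_abs_rpow h).aestronglyMeasurable]
  exact ENNReal.toReal_le_of_le_ofReal hσ h

lemma abs_le_rpow_of_lt {s y : ℝ} (hε : 1 ≤ ε) (hs : 0 < s) (hy : s < |y|) :
    |y| ≤ s ^ (1 - ε) * |y| ^ ε := by
  have hy0 : 0 < |y| := hs.trans hy
  calc |y| = |y| ^ (1 - ε) * |y| ^ ε := by
        rw [← Real.rpow_add hy0]; simp
    _ ≤ s ^ (1 - ε) * |y| ^ ε := by
        refine mul_le_mul_of_nonneg_right ?_ (by positivity)
        exact Real.rpow_le_rpow_of_nonpos hs hy.le (by linarith)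

lemma sq_le_rpow_of_le {s y : ℝ} (hε : ε ≤ 2) (hs : 0 < s) (hy : |y| ≤ s) :
    y ^ 2 ≤ s ^ (2 - ε) * |y| ^ ε := by
  rcases eq_or_ne y 0 with rfl | h0
  · have : (0 : ℝ) ≤ s ^ (2 - ε) * |(0 : ℝ)| ^ ε := by positivity
    simpa using this
  have hy0 : 0 < |y| := abs_pos.2 h0
  calc y ^ 2 = |y| ^ (2 - ε) * |y| ^ ε := by
        rw [← Real.rpow_add hy0]; simp
    _ ≤ s ^ (2 - ε) * |y| ^ ε := by
        refine mul_le_mul_of_nonneg_right ?_ (by positivity)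
        exact Real.rpow_le_rpow (abs_nonneg y) hy (by linarith)

lemma abs_le_add_rpow {M : ℝ} (hε : 1 ≤ ε) (hM : 0 < M) (y : ℝ) :
    |y| ≤ M + M ^ (1 - ε) * |y| ^ ε := by
  have h0 : 0 ≤ M ^ (1 - ε) * |y| ^ ε := by positivity
  rcases le_or_gt |y| M with h | h
  · linarith
  · linarith [abs_le_rpow_of_lt hε hM h]

lemma integrable_id_of_moment [IsProbabilityMeasure ν] (hε : 1 ≤ ε)
    (h : ∫⁻ x, ENNReal.ofReal (|x| ^ ε) ∂ν ≤ ENNReal.ofReal σ) :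
    Integrable (fun x : ℝ => x) ν := by
  refine Integrable.mono' ((integrable_const (1 : ℝ)).add (integrable_abs_rpow h))
    (by fun_prop) (Filter.Eventually.of_forall fun x => ?_)
  simpa using abs_le_add_rpow hε one_pos x

lemma integral_abs_le_of_moment [IsProbabilityMeasure ν] (hε : 1 ≤ ε) (hσ : 0 < σ)
    (h : ∫⁻ x, ENNReal.ofReal (|x| ^ ε) ∂ν ≤ ENNReal.ofReal σ) :
    ∫ x, |x| ∂ν ≤ 2 * σ ^ (1 / ε) := by
  -- Truncating at M = σ^{1/ε} balances the two parts, since then M^{1-ε} σ = M.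
  have hM : 0 < σ ^ (1 / ε) := by positivity
  have hi := integrable_abs_rpow h
  calc ∫ x, |x| ∂ν ≤ ∫ x, (σ ^ (1 / ε) + (σ ^ (1 / ε)) ^ (1 - ε) * |x| ^ ε) ∂ν :=
        integral_mono (integrable_id_of_moment hε h).abs
          ((integrable_const _).add (hi.const_mul _)) (abs_le_add_rpow hε hM)
    _ = σ ^ (1 / ε) + (σ ^ (1 / ε)) ^ (1 - ε) * ∫ x, |x| ^ ε ∂ν := by
        rw [integral_add (integrable_const _) (hi.const_mul _), integral_const_mul]
        simp
    _ ≤ σ ^ (1 / ε) + (σ ^ (1 / ε)) ^ (1 - ε) * σ := by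
        gcongr
        exact integral_abs_rpow_le hσ.le h
    _ = 2 * σ ^ (1 / ε) := by
        have : (σ ^ (1 / ε)) ^ (1 - ε) * σ = σ ^ (1 / ε) := by
          rw [← Real.rpow_mul hσ.le]
          nth_rewrite 2 [← Real.rpow_one σ]
          rw [← Real.rpow_add hσ]
          congr 1
          have : ε ≠ 0 := by linarith
          field_simp
          ring
        rw [this]; ring

lemma abs_integral_le_of_moment [IsProbabilityMeasure ν] (hε : 1 ≤ ε) (hσ : 0 < σ)
    (h : ∫⁻ x, ENNReal.ofReal (|x| ^ ε) ∂ν ≤ ENNReal.ofReal σ) :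
    |∫ x, x ∂ν| ≤ 2 * σ ^ (1 / ε) :=
  abs_integral_le_integral_abs.trans (integral_abs_le_of_moment hε hσ h)

/-- Jensen for a concave power. It serves with r = ε / 2 both for moments over the sampled arm and
for averages of bonuses over q. -/
lemma sum_mul_rpow_le_rpow_sum {ι : Type*} [Fintype ι] {p z : ι → ℝ} (hp : p ∈ stdSimplex ℝ ι)
    (hz : ∀ i, 0 ≤ z i) {r : ℝ} (hr0 : 0 ≤ r) (hr1 : r ≤ 1) :
    ∑ i, p i * z i ^ r ≤ (∑ i, p i * z i) ^ r := by
  have := (Real.concaveOn_rpow hr0 hr1).le_map_sum (t := Finset.univ) (w := p) (p := z)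
    (fun i _ => hp.1 i) hp.2 (fun i _ => hz i)
  simpa only [smul_eq_mul] using this

end HeavyTails

/-! ### One round: bias, stability and bonus. -/

section Round

variable {K d : ℕ} {ε σ β : ℝ} {φ : Fin K → Fin d → ℝ} {p q : Fin K → ℝ}

/-- The loss estimate with the bonus subtracted, clipped at `β / 2`. -/
def correctedEst (ε σ β : ℝ) (φ : Fin K → Fin d → ℝ) (p : Fin K → ℝ) (c : Fin K) (x : ℝ)
    (b : Fin K) : ℝ :=
  clippedEst (β / 2) φ p c x b - bonus ε σ (β / 2) φ p b

/-- The regret of `q` against arm `a` in the corrected estimates, less the stability term of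
exponential weights. -/
def stableRegret (ε σ β : ℝ) (φ : Fin K → Fin d → ℝ) (p q : Fin K → ℝ) (a c : Fin K) (x : ℝ) : ℝ :=
  (∑ b, q b * correctedEst ε σ β φ p c x b) - correctedEst ε σ β φ p c x a
    - ∑ b, q b * correctedEst ε σ β φ p c x b ^ 2 / β

lemma abs_clippedEst_le {s : ℝ} (hs : 0 ≤ s) (c : Fin K) (x : ℝ) (b : Fin K) :
    |clippedEst s φ p c x b| ≤ s := by
  unfold clippedEst
  split_ifs with h
  · exact h
  · simpa using hs

lemma bonus_nonneg (hσ : 0 ≤ σ) {s : ℝ} (hs : 0 ≤ s) (b : Fin K)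
    (hg : 0 ≤ invCovForm φ p b b) : 0 ≤ bonus ε σ s φ p b := by
  unfold bonus
  positivity

lemma abs_clippedEst_sub_lossEst_le {s : ℝ} (hε : 1 ≤ ε) (hs : 0 < s) (c : Fin K) (x : ℝ)
    (b : Fin K) :
    |clippedEst s φ p c x b - lossEst φ p c x b| ≤
      s ^ (1 - ε) * (|invCovForm φ p b c| ^ ε * |x| ^ ε) := by
  rw [← Real.mul_rpow (abs_nonneg _) (abs_nonneg _), ← abs_mul, ← lossEst]
  unfold clippedEst
  split_ifs with h
  · simp only [sub_self, abs_zero]; positivity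
  · rw [zero_sub, abs_neg]
    exact abs_le_rpow_of_lt hε hs (not_le.1 h)

lemma clippedEst_sq_le {s : ℝ} (hε : ε ≤ 2) (hs : 0 < s) (c : Fin K) (x : ℝ) (b : Fin K) :
    clippedEst s φ p c x b ^ 2 ≤ s ^ (2 - ε) * (|invCovForm φ p b c| ^ ε * |x| ^ ε) := by
  rw [← Real.mul_rpow (abs_nonneg _) (abs_nonneg _), ← abs_mul, ← lossEst]
  unfold clippedEst
  split_ifs with h
  · exact sq_le_rpow_of_le hε hs h
  · rw [zero_pow two_ne_zero]; positivity

lemma abs_correctedEst_le (hβ : 0 ≤ β) (hB0 : ∀ b, 0 ≤ bonus ε σ (β / 2) φ p b)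
    (hB : ∀ b, bonus ε σ (β / 2) φ p b ≤ β / 2) (c : Fin K) (x : ℝ) (b : Fin K) :
    |correctedEst ε σ β φ p c x b| ≤ β := by
  have h1 := abs_le.1 (abs_clippedEst_le (φ := φ) (p := p) (div_nonneg hβ zero_le_two) c x b)
  have h2 := hB0 b
  have h3 := hB b
  rw [correctedEst, abs_le]
  constructor <;> linarith

/-- A lower bound on the stable regret that is linear in the loss and its `ε`-th power. -/
lemma le_stableRegret (hε1 : 1 ≤ ε) (hε2 : ε ≤ 2) (hβ : 0 < β) (hq : ∀ b, 0 ≤ q b)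
    (hB0 : ∀ b, 0 ≤ bonus ε σ (β / 2) φ p b)
    (hB : ∀ b, bonus ε σ (β / 2) φ p b ≤ β / 2) (a c : Fin K) (x : ℝ) :
    ((∑ b, q b * invCovForm φ p b c) - invCovForm φ p a c) * x
      - (β / 2) ^ (1 - ε) *
          (2 * (∑ b, q b * |invCovForm φ p b c| ^ ε) + |invCovForm φ p a c| ^ ε) * |x| ^ ε
      + (bonus ε σ (β / 2) φ p a - 2 * ∑ b, q b * bonus ε σ (β / 2) φ p b)
      ≤ stableRegret ε σ β φ p q a c x := by
  set s := β / 2 with hs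
  have hs0 : 0 < s := by positivity
  have hpow : s ^ (2 - ε) = s * s ^ (1 - ε) := by
    rw [show 2 - ε = 1 + (1 - ε) by ring, Real.rpow_add hs0, Real.rpow_one]
  have hterm : ∀ b, q b * (invCovForm φ p b c * x
      - 2 * (s ^ (1 - ε) * (|invCovForm φ p b c| ^ ε * |x| ^ ε)) - 2 * bonus ε σ s φ p b) ≤
      q b * (correctedEst ε σ β φ p c x b - correctedEst ε σ β φ p c x b ^ 2 / β) := by
    intro b
    refine mul_le_mul_of_nonneg_left ?_ (hq b)
    have h1 := (abs_le.1 (abs_clippedEst_sub_lossEst_le (φ := φ) (p := p) hε1 hs0 c x b)).1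
    have h2 := clippedEst_sq_le (φ := φ) (p := p) hε2 hs0 c x b
    rw [hpow, mul_assoc] at h2
    rw [lossEst] at h1
    rw [correctedEst, ← hs]
    set y := clippedEst s φ p c x b
    set B := bonus ε σ s φ p b
    set D := s ^ (1 - ε) * (|invCovForm φ p b c| ^ ε * |x| ^ ε)
    have hBs : B ^ 2 ≤ s * B := by
      rw [sq]; exact mul_le_mul_of_nonneg_right (hB b) (hB0 b)
    -- Here (y - B)² ≤ 2y² + 2B² ≤ 2s(D + B), and β = 2s. So the stability term costs one more copy
    -- of the bias bound and one more of the bonus: hence the factors 2.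
    have h3 : (y - B) ^ 2 / β ≤ D + B := by
      rw [div_le_iff₀ hβ, show β = 2 * s by rw [hs]; ring]
      nlinarith [sq_nonneg (y + B)]
    linarith
  have ha : -(invCovForm φ p a c * x) - s ^ (1 - ε) * (|invCovForm φ p a c| ^ ε * |x| ^ ε)
      + bonus ε σ s φ p a ≤ -correctedEst ε σ β φ p c x a := by
    have h1 := (abs_le.1 (abs_clippedEst_sub_lossEst_le (φ := φ) (p := p) hε1 hs0 c x a)).2
    rw [lossEst] at h1
    rw [correctedEst, ← hs]
    linarith
  have hsum := Finset.sum_le_sum fun b (_ : b ∈ Finset.univ) => hterm b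
  have hl : ∑ b, q b * (invCovForm φ p b c * x
      - 2 * (s ^ (1 - ε) * (|invCovForm φ p b c| ^ ε * |x| ^ ε)) - 2 * bonus ε σ s φ p b) =
      (∑ b, q b * invCovForm φ p b c) * x
        - 2 * (s ^ (1 - ε) * ((∑ b, q b * |invCovForm φ p b c| ^ ε) * |x| ^ ε))
        - 2 * ∑ b, q b * bonus ε σ s φ p b := by
    simp only [Finset.sum_mul, Finset.mul_sum, ← Finset.sum_sub_distrib]
    exact Finset.sum_congr rfl fun b _ => by ring
  have hr : ∑ b, q b * (correctedEst ε σ β φ p c x b - correctedEst ε σ β φ p c x b ^ 2 / β) =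
      (∑ b, q b * correctedEst ε σ β φ p c x b)
        - ∑ b, q b * correctedEst ε σ β φ p c x b ^ 2 / β := by
    rw [← Finset.sum_sub_distrib]
    exact Finset.sum_congr rfl fun b _ => by ring
  rw [hl, hr] at hsum
  rw [stableRegret]
  linarith

/-- The bonus dominates the conditional `ε`-th moment of the loss estimate. -/
lemma sum_moment_le_bonus (hε1 : 1 ≤ ε) (hε2 : ε ≤ 2) (hσ : 0 ≤ σ) {s : ℝ} (hs : 0 ≤ s)
    (hp : p ∈ stdSimplex ℝ (Fin K)) (hS : IsUnit (covMatrix φ p).det) (b : Fin K) :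
    σ * s ^ (1 - ε) * ∑ c, p c * |invCovForm φ p b c| ^ ε ≤ bonus ε σ s φ p b := by
  unfold bonus
  refine mul_le_mul_of_nonneg_left ?_ (by positivity)
  rw [← sum_mul_invCovForm_sq hS]
  refine le_trans (le_of_eq ?_) (sum_mul_rpow_le_rpow_sum hp (fun c => sq_nonneg _)
    (by linarith) (by linarith))
  refine Finset.sum_congr rfl fun c _ => ?_
  rw [← sq_abs, ← Real.rpow_natCast, ← Real.rpow_mul (abs_nonneg _)]
  congr 2
  push_cast
  ring

/-- The expected instantaneous regret of `q` is at most the expected stable regret plus four times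
the expected bonus. -/
lemma regret_le_integral_stableRegret (hε1 : 1 ≤ ε) (hε2 : ε ≤ 2) (hσ : 0 < σ) (hβ : 0 < β)
    (hq : ∀ b, 0 ≤ q b) (hp : p ∈ stdSimplex ℝ (Fin K)) (hS : IsUnit (covMatrix φ p).det)
    (hB : ∀ b, bonus ε σ (β / 2) φ p b ≤ β / 2) {ν : Fin K → Measure ℝ}
    [∀ c, IsProbabilityMeasure (ν c)]
    (hν : ∀ c, ∫⁻ x, ENNReal.ofReal (|x| ^ ε) ∂(ν c) ≤ ENNReal.ofReal σ) {θ : Fin d → ℝ}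
    (hmean : ∀ c, ∫ x, x ∂(ν c) = φ c ⬝ᵥ θ) (a : Fin K)
    (hint : ∀ c, Integrable (stableRegret ε σ β φ p q a c) (ν c)) :
    (∑ b, q b * (φ b ⬝ᵥ θ)) - φ a ⬝ᵥ θ ≤
      (∑ c, p c * ∫ x, stableRegret ε σ β φ p q a c x ∂(ν c))
        + 4 * ∑ b, q b * bonus ε σ (β / 2) φ p b := by
  have hB0 : ∀ b, 0 ≤ bonus ε σ (β / 2) φ p b := fun b =>
    bonus_nonneg hσ.le (by positivity) b (invCovForm_self_nonneg hp.1 hS b)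
  have hM := sum_moment_le_bonus hε1 hε2 hσ.le (s := β / 2) (by positivity) hp hS
  set s := β / 2 with hs
  set D : Fin K → ℝ := fun c =>
    s ^ (1 - ε) * (2 * (∑ b, q b * |invCovForm φ p b c| ^ ε) + |invCovForm φ p a c| ^ ε) with hD
  have hD0 : ∀ c, 0 ≤ D c := fun c => by
    have : 0 ≤ ∑ b, q b * |invCovForm φ p b c| ^ ε :=
      Finset.sum_nonneg fun b _ => mul_nonneg (hq b) (by positivity)
    simp only [hD]
    positivity
  set E : ℝ := bonus ε σ s φ p a - 2 * ∑ b, q b * bonus ε σ s φ p b with hE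
  set A : Fin K → ℝ := fun c => (∑ b, q b * invCovForm φ p b c) - invCovForm φ p a c with hA
  have hlow : ∀ c, A c * (φ c ⬝ᵥ θ) - D c * σ + E ≤ ∫ x, stableRegret ε σ β φ p q a c x ∂(ν c) := by
    intro c
    have hi1 : Integrable (fun x : ℝ => A c * x) (ν c) :=
      (integrable_id_of_moment hε1 (hν c)).const_mul _
    have hi2 : Integrable (fun x : ℝ => D c * |x| ^ ε) (ν c) :=
      (integrable_abs_rpow (hν c)).const_mul _
    calc A c * (φ c ⬝ᵥ θ) - D c * σ + E
        ≤ A c * (φ c ⬝ᵥ θ) - D c * (∫ x, |x| ^ ε ∂(ν c)) + E := by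
          have := mul_le_mul_of_nonneg_left (integral_abs_rpow_le hσ.le (hν c)) (hD0 c)
          linarith
      _ = ∫ x, (A c * x - D c * |x| ^ ε + E) ∂(ν c) := by
          rw [integral_add (by exact hi1.sub hi2) (integrable_const _), integral_sub hi1 hi2,
            integral_const_mul, integral_const_mul, hmean]
          simp
      _ ≤ _ := integral_mono ((hi1.sub hi2).add (integrable_const _)) (hint c)
          (fun x => le_stableRegret hε1 hε2 hβ hq hB0 hB a c x)
  have hsum : ∑ c, p c * (A c * (φ c ⬝ᵥ θ) - D c * σ + E) ≤
      ∑ c, p c * ∫ x, stableRegret ε σ β φ p q a c x ∂(ν c) :=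
    Finset.sum_le_sum fun c _ => mul_le_mul_of_nonneg_left (hlow c) (hp.1 c)
  have hsplit : ∑ c, p c * (A c * (φ c ⬝ᵥ θ) - D c * σ + E) =
      (∑ c, p c * A c * (φ c ⬝ᵥ θ)) - σ * (∑ c, p c * D c) + E := by
    have : E = ∑ c, p c * E := by rw [← Finset.sum_mul, hp.2, one_mul]
    conv_rhs => rw [this]
    simp only [Finset.mul_sum, ← Finset.sum_sub_distrib, ← Finset.sum_add_distrib]
    exact Finset.sum_congr rfl fun c _ => by ring
  have hAsum : ∑ c, p c * A c * (φ c ⬝ᵥ θ) = (∑ b, q b * (φ b ⬝ᵥ θ)) - φ a ⬝ᵥ θ := by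
    have hrep : ∑ b, q b * (φ b ⬝ᵥ θ) =
        ∑ b, q b * ∑ c, p c * invCovForm φ p b c * (φ c ⬝ᵥ θ) :=
      Finset.sum_congr rfl fun b _ => by rw [sum_mul_invCovForm_mul_dotProduct hS]
    rw [hrep, ← sum_mul_invCovForm_mul_dotProduct hS a θ]
    simp only [hA, mul_sub, sub_mul, Finset.sum_sub_distrib, Finset.mul_sum, Finset.sum_mul]
    congr 1
    rw [Finset.sum_comm]
    exact Finset.sum_congr rfl fun b _ => Finset.sum_congr rfl fun c _ => by ring
  -- The bonus of a appearing here cancels against the one in `E`; the two copies of the q-average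
  -- here and the two in `E` make up the four in the conclusion.
  have hDsum : σ * (∑ c, p c * D c) ≤
      2 * (∑ b, q b * bonus ε σ s φ p b) + bonus ε σ s φ p a := by
    have h1 : σ * (∑ c, p c * D c) =
        2 * (∑ b, q b * (σ * s ^ (1 - ε) * ∑ c, p c * |invCovForm φ p b c| ^ ε))
          + σ * s ^ (1 - ε) * ∑ c, p c * |invCovForm φ p a c| ^ ε := by
      simp only [hD, mul_add, Finset.sum_add_distrib, Finset.mul_sum]
      congr 1
      · rw [Finset.sum_comm]
        exact Finset.sum_congr rfl fun b _ => Finset.sum_congr rfl fun c _ => by ring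
      · exact Finset.sum_congr rfl fun c _ => by ring
    rw [h1]
    have h2 : ∑ b, q b * (σ * s ^ (1 - ε) * ∑ c, p c * |invCovForm φ p b c| ^ ε) ≤
        ∑ b, q b * bonus ε σ s φ p b :=
      Finset.sum_le_sum fun b _ => mul_le_mul_of_nonneg_left (hM b) (hq b)
    linarith [hM a]
  rw [hsplit, hAsum] at hsum
  linarith

end Round

/-! ### Integration against a conditional law. -/

section ConditionalLaw

variable {Ω Ω' : Type*} [MeasurableSpace Ω] [MeasurableSpace Ω'] {μ : Measure Ω}
  [IsFiniteMeasure μ] {X : Ω → Ω'} {Y : Ω → ℝ} {A : Set Ω} {w : Ω' → ENNReal}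
  {κ : ProbabilityTheory.Kernel Ω' ℝ} [ProbabilityTheory.IsMarkovKernel κ]

/-- If, on the event `A` of conditional probability `w`, the variable `Y` has conditional law `κ`
given `X`, then `(X, Y)` has on `A` the corresponding composition-product law. -/
lemma map_restrict_eq_compProd (hX : Measurable X) (hY : Measurable Y)
    (hw : Measurable w)
    (h : ∀ (G : Set Ω') (B : Set ℝ), MeasurableSet G → MeasurableSet B →
      μ (X ⁻¹' G ∩ A ∩ Y ⁻¹' B) = ∫⁻ ω in X ⁻¹' G, w (X ω) * κ (X ω) B ∂μ) :
    (μ.restrict A).map (fun ω => (X ω, Y ω)) = ((μ.map X).withDensity w).compProd κ := by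
  refine Measure.ext_prod fun {G B} hG hB => ?_
  rw [Measure.map_apply (hX.prodMk hY) (hG.prod hB),
    Measure.restrict_apply ((hX.prodMk hY) (hG.prod hB)), Measure.compProd_apply_prod hG hB,
    setLIntegral_withDensity_eq_setLIntegral_mul _ hw (κ.measurable_coe hB) hG,
    setLIntegral_map hG (by exact hw.mul (κ.measurable_coe hB)) hX]
  simp only [Pi.mul_apply]
  rw [← h G B hG hB]
  congr 1
  ext ω
  simp only [Set.mem_inter_iff, Set.mem_preimage, Set.mem_prod]
  tauto

lemma setLIntegral_eq_of_condLaw (hX : Measurable X) (hY : Measurable Y)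
    (hw : Measurable w)
    (h : ∀ (G : Set Ω') (B : Set ℝ), MeasurableSet G → MeasurableSet B →
      μ (X ⁻¹' G ∩ A ∩ Y ⁻¹' B) = ∫⁻ ω in X ⁻¹' G, w (X ω) * κ (X ω) B ∂μ)
    {F : Ω' × ℝ → ENNReal} (hF : Measurable F) :
    ∫⁻ ω in A, F (X ω, Y ω) ∂μ = ∫⁻ ω, w (X ω) * ∫⁻ x, F (X ω, x) ∂(κ (X ω)) ∂μ := by
  have hm : Measurable fun ω' => ∫⁻ x, F (ω', x) ∂(κ ω') := hF.lintegral_kernel_prod_right'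
  rw [← lintegral_map (f := F) hF (hX.prodMk hY), map_restrict_eq_compProd hX hY hw h,
    Measure.lintegral_compProd hF, lintegral_withDensity_eq_lintegral_mul _ hw hm,
    lintegral_map (by exact hw.mul hm) hX]
  rfl

/-- The uniform bound C on conditional absolute integrals gives integrability of F under the
composition product, after which Fubini applies. -/
lemma setIntegral_eq_of_condLaw (hX : Measurable X) (hY : Measurable Y)
    (hw : Measurable w) (hw_top : ∀ ω', w ω' ≠ ⊤)
    (h : ∀ (G : Set Ω') (B : Set ℝ), MeasurableSet G → MeasurableSet B →
      μ (X ⁻¹' G ∩ A ∩ Y ⁻¹' B) = ∫⁻ ω in X ⁻¹' G, w (X ω) * κ (X ω) B ∂μ)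
    {F : Ω' × ℝ → ℝ} (hF : Measurable F) {C : ENNReal} (hC : C ≠ ⊤)
    (hFC : ∀ ω', ∫⁻ x, ‖F (ω', x)‖ₑ ∂(κ ω') ≤ C) :
    IntegrableOn (fun ω => F (X ω, Y ω)) A μ ∧
      Integrable (fun ω => (w (X ω)).toReal * ∫ x, F (X ω, x) ∂(κ (X ω))) μ ∧
      ∫ ω in A, F (X ω, Y ω) ∂μ = ∫ ω, (w (X ω)).toReal * ∫ x, F (X ω, x) ∂(κ (X ω)) ∂μ := by
  have hint : IntegrableOn (fun ω => F (X ω, Y ω)) A μ := by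
    refine ⟨(hF.comp (hX.prodMk hY)).aestronglyMeasurable, ?_⟩
    rw [hasFiniteIntegral_iff_enorm,
      setLIntegral_eq_of_condLaw hX hY hw h (F := fun z => ‖F z‖ₑ) hF.enorm]
    have hwi : ∫⁻ ω, w (X ω) ∂μ = μ A := by
      have := h Set.univ Set.univ MeasurableSet.univ MeasurableSet.univ
      simpa using this.symm
    calc _ ≤ ∫⁻ ω, w (X ω) * C ∂μ := lintegral_mono fun ω => by gcongr; exact hFC _
      _ = μ A * C := by rw [lintegral_mul_const' _ _ hC, hwi]
      _ < ⊤ := ENNReal.mul_lt_top (measure_lt_top _ _) hC.lt_top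
  have hmap := map_restrict_eq_compProd hX hY hw h
  have hXY : Measurable fun ω => (X ω, Y ω) := hX.prodMk hY
  have hint' : Integrable F (((μ.map X).withDensity w).compProd κ) := by
    rw [← hmap, integrable_map_measure hF.aestronglyMeasurable hXY.aemeasurable]
    exact hint
  have hsm : StronglyMeasurable fun ω' => ∫ x, F (ω', x) ∂(κ ω') :=
    hF.stronglyMeasurable.integral_kernel_prod_right'
  have hfin : ∀ᵐ ω' ∂(μ.map X), w ω' < ⊤ := Filter.Eventually.of_forall fun ω' =>
    (hw_top ω').lt_top
  -- The measure is viewed as a constant kernel on a one-point space, the form in which marginal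
  -- integrability is applied.
  have hi2 : Integrable (fun ω' => ∫ x, F (ω', x) ∂(κ ω')) ((μ.map X).withDensity w) :=
    MeasureTheory.Integrable.integral_compProd
      (κ := ProbabilityTheory.Kernel.const Unit ((μ.map X).withDensity w))
      (η := ProbabilityTheory.Kernel.prodMkLeft Unit κ) (a := ()) hint'
  rw [integrable_withDensity_iff_integrable_smul' hw hfin,
    integrable_map_measure (by
      exact (hw.ennreal_toReal.stronglyMeasurable.smul hsm).aestronglyMeasurable)
      hX.aemeasurable] at hi2
  refine ⟨hint, hi2, ?_⟩
  rw [← integral_map (f := F) hXY.aemeasurable hF.aestronglyMeasurable, hmap,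
    Measure.integral_compProd hint', integral_withDensity_eq_integral_toReal_smul hw hfin,
    integral_map hX.aemeasurable (by
      exact (hw.ennreal_toReal.stronglyMeasurable.smul hsm).aestronglyMeasurable)]
  rfl

end ConditionalLaw

/-! ### Conditioning on the past of a round. -/

section Interaction

variable {Ω : Type*} [mΩ : MeasurableSpace Ω] {K d : ℕ} {μ : Measure Ω}
  {𝒢 : Filtration ℕ mΩ} {T : ℕ} {φ : Fin K → Fin d → ℝ} {θ : ℕ → Ω → Fin d → ℝ}
  {ν : ℕ → Fin K → Ω → Measure ℝ} {ℓ : ℕ → Fin K → Ω → ℝ} {p : ℕ → Ω → Fin K → ℝ}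
  {arm : ℕ → Ω → Fin K}

lemma IsAdversarialInteraction.measurableSet_arm_eq
    (h : IsAdversarialInteraction μ 𝒢 T φ θ ν ℓ p arm) {t : ℕ} (ht : t < T) (c : Fin K) :
    MeasurableSet {ω | arm t ω = c} :=
  𝒢.le (t + 1) _ (h.arm_meas t ht (measurableSet_singleton c))

/-- The conditioning variable is the identity from Ω to Ω with the σ-algebra 𝒢 t, so F may depend on
the whole past. The positive part of p is the real value of the density `ENNReal.ofReal (p t ω c)`.
-/
lemma IsAdversarialInteraction.setIntegral_arm_eq [IsFiniteMeasure μ]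
    (h : IsAdversarialInteraction μ 𝒢 T φ θ ν ℓ p arm) {t : ℕ} (ht : t < T)
    (hp : Measurable[𝒢 t] (p t)) (b c : Fin K) {F : Ω × ℝ → ℝ}
    (hF : Measurable[(𝒢 t).prod inferInstance] F) {C : ENNReal} (hC : C ≠ ⊤)
    (hFC : ∀ ω, ∫⁻ x, ‖F (ω, x)‖ₑ ∂(ν t b ω) ≤ C) :
    IntegrableOn (fun ω => F (ω, ℓ t b ω)) {ω | arm t ω = c} μ ∧
      Integrable (fun ω => max (p t ω c) 0 * ∫ x, F (ω, x) ∂(ν t b ω)) μ ∧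
      ∫ ω in {ω | arm t ω = c}, F (ω, ℓ t b ω) ∂μ =
        ∫ ω, max (p t ω c) 0 * ∫ x, F (ω, x) ∂(ν t b ω) ∂μ := by
  let κ : @ProbabilityTheory.Kernel Ω ℝ (𝒢 t) _ :=
    @ProbabilityTheory.Kernel.mk Ω ℝ (𝒢 t) _ (ν t b)
      (@Measure.measurable_of_measurable_coe ℝ Ω _ (𝒢 t) _ (h.law_meas t ht b))
  have : @ProbabilityTheory.IsMarkovKernel Ω ℝ (𝒢 t) _ κ :=
    @ProbabilityTheory.IsMarkovKernel.mk Ω ℝ (𝒢 t) _ κ (h.law_prob t ht b)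
  have hpc : Measurable[𝒢 t] fun ω => ENNReal.ofReal (p t ω c) :=
    ((measurable_pi_apply c).comp hp).ennreal_ofReal
  have key := @setIntegral_eq_of_condLaw Ω Ω mΩ (𝒢 t) μ _ id (ℓ t b) {ω | arm t ω = c}
    (fun ω => ENNReal.ofReal (p t ω c)) κ _ (measurable_id'' (𝒢.le t)) (h.loss_meas t ht b) hpc
    (fun _ => ENNReal.ofReal_ne_top) (fun G B hG hB => h.joint_law t ht b c G B hG hB) F hF C hC hFC
  simp only [id, ENNReal.toReal_ofReal'] at key
  exact key

/-- Expectations over one round are computed by conditioning on what precedes it; `g c` is the arm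
whose loss is looked at when arm `c` is played. -/
lemma IsAdversarialInteraction.integral_round [IsFiniteMeasure μ]
    (h : IsAdversarialInteraction μ 𝒢 T φ θ ν ℓ p arm) {t : ℕ} (ht : t < T)
    (hp : Measurable[𝒢 t] (p t)) (g : Fin K → Fin K) {F : Fin K → Ω × ℝ → ℝ}
    (hF : ∀ c, Measurable[(𝒢 t).prod inferInstance] (F c)) {C : ENNReal} (hC : C ≠ ⊤)
    (hFC : ∀ c ω, ∫⁻ x, ‖F c (ω, x)‖ₑ ∂(ν t (g c) ω) ≤ C) :
    Integrable (fun ω => F (arm t ω) (ω, ℓ t (g (arm t ω)) ω)) μ ∧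
      Integrable (fun ω => ∑ c, max (p t ω c) 0 * ∫ x, F c (ω, x) ∂(ν t (g c) ω)) μ ∧
      ∫ ω, F (arm t ω) (ω, ℓ t (g (arm t ω)) ω) ∂μ =
        ∫ ω, ∑ c, max (p t ω c) 0 * ∫ x, F c (ω, x) ∂(ν t (g c) ω) ∂μ := by
  have key := fun c => h.setIntegral_arm_eq ht hp (g c) c (hF c) hC (hFC c)
  have hA := h.measurableSet_arm_eq ht
  have heq : (fun ω => F (arm t ω) (ω, ℓ t (g (arm t ω)) ω)) =
      fun ω => ∑ c, {ω | arm t ω = c}.indicator (fun ω => F c (ω, ℓ t (g c) ω)) ω := by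
    funext ω
    rw [Finset.sum_eq_single (arm t ω)]
    · simp
    · intro c _ hc
      exact Set.indicator_of_notMem (fun hω => hc hω.symm) _
    · simp
  have hi : ∀ c, Integrable
      ({ω | arm t ω = c}.indicator (fun ω => F c (ω, ℓ t (g c) ω))) μ := fun c =>
    (integrable_indicator_iff (hA c)).2 (key c).1
  refine ⟨?_, integrable_finsetSum _ fun c _ => (key c).2.1, ?_⟩
  · rw [heq]
    exact integrable_finsetSum _ fun c _ => hi c
  · rw [heq, integral_finsetSum _ fun c _ => hi c,
      integral_finsetSum _ fun c _ => (key c).2.1]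
    refine Finset.sum_congr rfl fun c _ => ?_
    rw [integral_indicator (hA c)]
    exact (key c).2.2

end Interaction

/-! ### Tuning of the parameters. -/

section Parameters

variable {K d T : ℕ} {ε σ : ℝ}

lemma invRate_eq (hσ : 0 < σ) (hd : 0 < d) (hT : 0 < T) (hK : 0 < Real.log K) (hε : 0 < ε) :
    invRate K d T ε σ =
      σ ^ (1 / ε) * (d : ℝ) ^ (1 / 2 : ℝ) * (Real.log K / T) ^ (-(1 / ε)) := by
  have hd' : (0 : ℝ) < d := by exact_mod_cast hd
  have hT' : (0 : ℝ) < T := by exact_mod_cast hT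
  have h1 : Real.log K / (σ * (d : ℝ) ^ (ε / 2) * T) =
      σ⁻¹ * ((d : ℝ) ^ (ε / 2))⁻¹ * (Real.log K / T) := by
    field_simp
  rw [invRate, h1, Real.mul_rpow (by positivity) (by positivity),
    Real.mul_rpow (by positivity) (by positivity), Real.inv_rpow hσ.le,
    Real.inv_rpow (by positivity), Real.rpow_neg hσ.le, inv_inv,
    Real.rpow_neg (by positivity), inv_inv, ← Real.rpow_mul hd'.le]
  congr 3
  field_simp

lemma invRate_pos (hσ : 0 < σ) (hd : 0 < d) (hT : 0 < T) (hK : 0 < Real.log K) :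
    0 < invRate K d T ε σ := by
  have hd' : (0 : ℝ) < d := by exact_mod_cast hd
  have hT' : (0 : ℝ) < T := by exact_mod_cast hT
  unfold invRate
  positivity

lemma explRate_eq (hσ : 0 < σ) (hd : 0 < d) (hT : 0 < T) (hK : 0 < Real.log K) (hε : 0 < ε) :
    explRate K d T ε σ = 4 * (Real.log K / T) ^ (2 / ε) := by
  have hd' : (0 : ℝ) < d := by exact_mod_cast hd
  have hT' : (0 : ℝ) < T := by exact_mod_cast hT
  have hr : 0 < Real.log K / T := by positivity
  have hsq : ∀ {x : ℝ} (y : ℝ), 0 < x → (x ^ y) ^ 2 = x ^ (2 * y) := fun {x} y hx => by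
    rw [← Real.rpow_natCast, ← Real.rpow_mul hx.le]
    congr 1
    push_cast
    ring
  rw [explRate, invRate_eq hσ hd hT hK hε, mul_pow, mul_pow, hsq _ hσ, hsq _ hd', hsq _ hr,
    show 2 * (1 / ε) = 2 / ε by ring, show 2 * (1 / 2 : ℝ) = 1 by ring, Real.rpow_one,
    show 2 * -(1 / ε) = -(2 / ε) by ring, Real.rpow_neg hr.le]
  have h1 : 0 < σ ^ (2 / ε) := by positivity
  have h2 : 0 < (Real.log K / T) ^ (2 / ε) := by positivity
  field_simp

lemma explRate_pos (hσ : 0 < σ) (hd : 0 < d) (hT : 0 < T) (hK : 0 < Real.log K) :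
    0 < explRate K d T ε σ := by
  have hd' : (0 : ℝ) < d := by exact_mod_cast hd
  have := invRate_pos (ε := ε) hσ hd hT hK
  unfold explRate
  positivity

/-- The order of the regret, in terms of the ratio `log K / T`. -/
lemma rate_eq (hT : 0 < T) (hK : 0 < Real.log K) :
    σ ^ (1 / ε) * Real.log K ^ (1 - 1 / ε) * (d : ℝ) ^ (1 / 2 : ℝ) * (T : ℝ) ^ (1 / ε) =
      σ ^ (1 / ε) * (d : ℝ) ^ (1 / 2 : ℝ) * (Real.log K / T) ^ (1 - 1 / ε) * T := by
  have hT' : (0 : ℝ) < T := by exact_mod_cast hT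
  rw [Real.div_rpow hK.le hT'.le, Real.rpow_sub hT', Real.rpow_one]
  have h1 : 0 < (T : ℝ) ^ (1 / ε) := by positivity
  field_simp

lemma rate_eq_invRate_mul_log (hσ : 0 < σ) (hd : 0 < d) (hT : 0 < T) (hK : 0 < Real.log K)
    (hε : 0 < ε) :
    σ ^ (1 / ε) * Real.log K ^ (1 - 1 / ε) * (d : ℝ) ^ (1 / 2 : ℝ) * (T : ℝ) ^ (1 / ε) =
      invRate K d T ε σ * Real.log K := by
  have hT' : (0 : ℝ) < T := by exact_mod_cast hT
  have hr : 0 < Real.log K / T := by positivity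
  rw [rate_eq hT hK, invRate_eq hσ hd hT hK hε, sub_eq_neg_add, Real.rpow_add hr, Real.rpow_one]
  field_simp

lemma invRate_rpow_mul_log (hσ : 0 < σ) (hd : 0 < d) (hT : 0 < T) (hK : 0 < Real.log K)
    (hε : 0 < ε) :
    invRate K d T ε σ ^ ε * Real.log K = σ * (d : ℝ) ^ (ε / 2) * T := by
  have hd' : (0 : ℝ) < d := by exact_mod_cast hd
  have hT' : (0 : ℝ) < T := by exact_mod_cast hT
  rw [invRate, ← Real.rpow_mul (by positivity), show -(1 / ε) * ε = -1 by field_simp,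
    Real.rpow_neg_one]
  field_simp

lemma one_le_rpow_half (hd : 0 < d) : 1 ≤ (d : ℝ) ^ (1 / 2 : ℝ) :=
  Real.one_le_rpow (by exact_mod_cast hd) (by norm_num)

/-- With r = log K / T the exploration rate is 4 r^{2/ε}. The hypothesis forces r ≤ 1, and 2/ε ≥ 1 -
1/ε because ε - 1 ≤ 2. -/
lemma explRate_mul_le (hσ : 0 < σ) (hd : 0 < d) (hT : 0 < T) (hK : 0 < Real.log K)
    (hε1 : 1 < ε) (hε2 : ε ≤ 2) (hγ : explRate K d T ε σ ≤ 1 / 2) :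
    explRate K d T ε σ * σ ^ (1 / ε) * T ≤
      4 * (σ ^ (1 / ε) * Real.log K ^ (1 - 1 / ε) * (d : ℝ) ^ (1 / 2 : ℝ) * (T : ℝ) ^ (1 / ε)) := by
  have hε : 0 < ε := by linarith
  have hT' : (0 : ℝ) < T := by exact_mod_cast hT
  have hr : 0 < Real.log K / T := by positivity
  rw [rate_eq hT hK]
  rw [explRate_eq hσ hd hT hK hε] at hγ ⊢
  set r := Real.log K / T
  have hr1 : r ≤ 1 := by
    by_contra! h
    have := Real.one_le_rpow h.le (show 0 ≤ 2 / ε by positivity)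
    linarith
  have h1 : r ^ (2 / ε) ≤ r ^ (1 - 1 / ε) := by
    refine Real.rpow_le_rpow_of_exponent_ge hr hr1 ?_
    have : 1 - 1 / ε = (ε - 1) / ε := by field_simp
    rw [this]
    gcongr
    linarith
  have h2 : r ^ (1 - 1 / ε) ≤ (d : ℝ) ^ (1 / 2 : ℝ) * r ^ (1 - 1 / ε) :=
    le_mul_of_one_le_left (by positivity) (one_le_rpow_half hd)
  calc 4 * r ^ (2 / ε) * σ ^ (1 / ε) * T = 4 * σ ^ (1 / ε) * T * r ^ (2 / ε) := by ring
    _ ≤ 4 * σ ^ (1 / ε) * T * ((d : ℝ) ^ (1 / 2 : ℝ) * r ^ (1 - 1 / ε)) := by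
        gcongr
        exact h1.trans h2
    _ = _ := by ring

/-- For short horizons the trivial bound is of the right order. -/
lemma mul_le_rate_of_explRate_gt (hσ : 0 < σ) (hd : 0 < d) (hT : 0 < T) (hK : 0 < Real.log K)
    (hε1 : 1 < ε) (hε2 : ε ≤ 2) (hγ : 1 / 2 < explRate K d T ε σ) :
    σ ^ (1 / ε) * T ≤
      8 * (σ ^ (1 / ε) * Real.log K ^ (1 - 1 / ε) * (d : ℝ) ^ (1 / 2 : ℝ) * (T : ℝ) ^ (1 / ε)) := by
  have hε : 0 < ε := by linarith
  have hT' : (0 : ℝ) < T := by exact_mod_cast hT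
  have hr : 0 < Real.log K / T := by positivity
  rw [rate_eq hT hK]
  rw [explRate_eq hσ hd hT hK hε] at hγ
  set r := Real.log K / T
  have he0 : 0 ≤ 1 - 1 / ε := by
    rw [sub_nonneg, div_le_one hε]
    exact hε1.le
  have h1 : 1 / 8 ≤ r ^ (1 - 1 / ε) := by
    rcases le_or_gt 1 r with h | h
    · have := Real.one_le_rpow h he0
      linarith
    · have h3 : r ^ (2 / ε) ≤ r ^ (1 - 1 / ε) := by
        refine Real.rpow_le_rpow_of_exponent_ge hr h.le ?_
        have : 1 - 1 / ε = (ε - 1) / ε := by field_simp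
        rw [this]
        gcongr
        linarith
      linarith
  have h2 : r ^ (1 - 1 / ε) ≤ (d : ℝ) ^ (1 / 2 : ℝ) * r ^ (1 - 1 / ε) :=
    le_mul_of_one_le_left (by positivity) (one_le_rpow_half hd)
  calc σ ^ (1 / ε) * T = 8 * σ ^ (1 / ε) * T * (1 / 8) := by ring
    _ ≤ 8 * σ ^ (1 / ε) * T * ((d : ℝ) ^ (1 / 2 : ℝ) * r ^ (1 - 1 / ε)) := by
        gcongr
        exact h1.trans h2
    _ = _ := by ring

lemma mix_mem_stdSimplex {γ : ℝ} {p₀ q : Fin K → ℝ} (hγ : 0 ≤ γ) (hγ1 : γ ≤ 1)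
    (hp₀ : p₀ ∈ stdSimplex ℝ (Fin K)) (hq : q ∈ stdSimplex ℝ (Fin K)) :
    mix γ p₀ q ∈ stdSimplex ℝ (Fin K) :=
  convex_stdSimplex ℝ (Fin K) hq hp₀ (sub_nonneg.2 hγ1) hγ (by ring)

variable {φ : Fin K → Fin d → ℝ} {p₀ q : Fin K → ℝ}

lemma bonus_le_clipLevel (hσ : 0 < σ) (hd : 0 < d) (hT : 0 < T) (hK : 0 < Real.log K)
    (hε : 0 < ε) (hγ : explRate K d T ε σ ≤ 1) (hp₀ : IsGOptimalDesign φ p₀)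
    (hq : q ∈ stdSimplex ℝ (Fin K)) (b : Fin K) :
    bonus ε σ (invRate K d T ε σ / 2) φ (mix (explRate K d T ε σ) p₀ q) b ≤
      invRate K d T ε σ / 2 := by
  have hβ := invRate_pos (ε := ε) hσ hd hT hK
  have hγ0 := explRate_pos (ε := ε) hσ hd hT hK
  have hd' : (0 : ℝ) < d := by exact_mod_cast hd
  have hS := isUnit_det_covMatrix_mix hγ0 hγ hq.1 hp₀.mem.1 hp₀.nonsing
  have hg0 := invCovForm_self_nonneg (mix_mem_stdSimplex hγ0.le hγ hp₀.mem hq).1 hS b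
  have hM : 0 < σ ^ (1 / ε) := by positivity
  -- The definition of γ is exactly d / γ = (s / σ^{1/ε})² with s = β / 2.
  have hg : invCovForm φ (mix (explRate K d T ε σ) p₀ q) b b ≤
      (invRate K d T ε σ / 2 / σ ^ (1 / ε)) ^ (2 : ℝ) := by
    refine (invCovForm_mix_self_le hγ0 hγ hq.1 hp₀.mem.1 hp₀.nonsing b).trans ?_
    refine (div_le_div_of_nonneg_right (hp₀.invCovForm_self_le b) hγ0.le).trans (le_of_eq ?_)
    have : σ ^ (2 / ε) = (σ ^ (1 / ε)) ^ 2 := by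
      rw [← Real.rpow_natCast, ← Real.rpow_mul hσ.le]
      congr 1
      push_cast
      ring
    rw [explRate, this, Real.rpow_two]
    field_simp
    norm_num
  set s := invRate K d T ε σ / 2 with hs
  have hs0 : 0 < s := by positivity
  have h1 : invCovForm φ (mix (explRate K d T ε σ) p₀ q) b b ^ (ε / 2) ≤ s ^ ε / σ := by
    refine (Real.rpow_le_rpow hg0 hg (by positivity)).trans (le_of_eq ?_)
    rw [← Real.rpow_mul (by positivity), show 2 * (ε / 2) = ε by ring,
      Real.div_rpow hs0.le hM.le, ← Real.rpow_mul hσ.le, show 1 / ε * ε = 1 by field_simp,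
      Real.rpow_one]
  calc bonus ε σ s φ (mix (explRate K d T ε σ) p₀ q) b
      ≤ σ * s ^ (1 - ε) * (s ^ ε / σ) := mul_le_mul_of_nonneg_left h1 (by positivity)
    _ = s ^ (1 - ε) * s ^ ε := by field_simp
    _ = s := by rw [← Real.rpow_add hs0]; simp

lemma sum_mul_bonus_le (hσ : 0 < σ) (hd : 0 < d) (hT : 0 < T) (hK : 0 < Real.log K)
    (hε1 : 1 < ε) (hε2 : ε ≤ 2) (hγ : explRate K d T ε σ ≤ 1 / 2) (hp₀ : IsGOptimalDesign φ p₀)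
    (hq : q ∈ stdSimplex ℝ (Fin K)) :
    T * ∑ b, q b * bonus ε σ (invRate K d T ε σ / 2) φ (mix (explRate K d T ε σ) p₀ q) b ≤
      4 * (invRate K d T ε σ * Real.log K) := by
  have hε : 0 < ε := by linarith
  have hβ := invRate_pos (ε := ε) hσ hd hT hK
  have hγ0 := explRate_pos (ε := ε) hσ hd hT hK
  have hβL := invRate_rpow_mul_log hσ hd hT hK hε
  have hd' : (0 : ℝ) < d := by exact_mod_cast hd
  have hT' : (0 : ℝ) < T := by exact_mod_cast hT
  have hγ1 : explRate K d T ε σ ≤ 1 := by linarith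
  have hS := isUnit_det_covMatrix_mix hγ0 hγ1 hq.1 hp₀.mem.1 hp₀.nonsing
  have hp := mix_mem_stdSimplex hγ0.le hγ1 hp₀.mem hq
  -- This is where γ ≤ 1/2 is needed: it lets the trace identity for p bound an average over q.
  have hqp : ∀ b, q b ≤ 2 * mix (explRate K d T ε σ) p₀ q b := fun b => by
    have h1 := hq.1 b
    have h2 := mul_nonneg hγ0.le (hp₀.mem.1 b)
    simp only [mix]
    nlinarith
  set p := mix (explRate K d T ε σ) p₀ q
  have hg0 := invCovForm_self_nonneg hp.1 hS
  have h1 : ∑ b, q b * invCovForm φ p b b ^ (ε / 2) ≤ 2 * (d : ℝ) ^ (ε / 2) := by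
    refine (sum_mul_rpow_le_rpow_sum hq hg0 (by positivity) (by linarith)).trans ?_
    have h2 : ∑ b, q b * invCovForm φ p b b ≤ 2 * d := by
      rw [← sum_mul_invCovForm_self hS, Finset.mul_sum]
      refine Finset.sum_le_sum fun b _ => ?_
      rw [← mul_assoc]
      exact mul_le_mul_of_nonneg_right (hqp b) (hg0 b)
    refine (Real.rpow_le_rpow (Finset.sum_nonneg fun b _ => mul_nonneg (hq.1 b) (hg0 b)) h2
      (by positivity)).trans ?_
    rw [Real.mul_rpow zero_le_two hd'.le]
    gcongr
    exact Real.rpow_le_self_of_one_le one_le_two (by linarith)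
  set β := invRate K d T ε σ
  have h3 : (β / 2) ^ (1 - ε) ≤ 2 * β ^ (1 - ε) := by
    rw [Real.div_rpow hβ.le zero_le_two, div_eq_inv_mul, ← Real.rpow_neg zero_le_two, neg_sub]
    gcongr
    exact Real.rpow_le_self_of_one_le one_le_two (by linarith)
  have h4 : ∑ b, q b * bonus ε σ (β / 2) φ p b =
      σ * (β / 2) ^ (1 - ε) * ∑ b, q b * invCovForm φ p b b ^ (ε / 2) := by
    rw [Finset.mul_sum]
    refine Finset.sum_congr rfl fun b _ => ?_
    rw [bonus]
    ring
  rw [h4]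
  -- The 4 is 2 · 2, from 2^{ε-1} ≤ 2 and 2^{ε/2} ≤ 2; then β^ε log K = σ d^{ε/2} T, the equation
  -- defining β.
  calc T * (σ * (β / 2) ^ (1 - ε) * ∑ b, q b * invCovForm φ p b b ^ (ε / 2))
      ≤ T * (σ * (2 * β ^ (1 - ε)) * (2 * (d : ℝ) ^ (ε / 2))) := by
        gcongr
        exact Finset.sum_nonneg fun b _ => mul_nonneg (hq.1 b) (Real.rpow_nonneg (hg0 b) _)
    _ = 4 * (β ^ (1 - ε) * (σ * (d : ℝ) ^ (ε / 2) * T)) := by ring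
    _ = 4 * (β ^ (1 - ε) * β ^ ε * Real.log K) := by rw [← hβL]; ring
    _ = 4 * (β * Real.log K) := by rw [← Real.rpow_add hβ]; simp

end Parameters

/-! ### Measurability and boundedness of the estimates. -/

section Measurability

variable {K d : ℕ} (φ : Fin K → Fin d → ℝ)

lemma measurable_invCovForm (b c : Fin K) : Measurable fun p => invCovForm φ p b c := by
  have hcov : Continuous fun p : Fin K → ℝ => covMatrix φ p := by
    unfold covMatrix
    fun_prop
  -- The formula det⁻¹ · adjugate also holds at singular matrices, where both sides are 0, so no
  -- case distinction is needed.
  have h : (fun p => invCovForm φ p b c) = fun p =>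
      ((covMatrix φ p).det)⁻¹ * (φ b ⬝ᵥ ((covMatrix φ p).adjugate *ᵥ φ c)) := by
    funext p
    rw [invCovForm, Matrix.inv_def, Ring.inverse_eq_inv', smul_mulVec, dotProduct_smul,
      smul_eq_mul]
  rw [h]
  refine (hcov.matrix_det.measurable.inv).mul (Continuous.measurable ?_)
  exact continuous_const.dotProduct (hcov.matrix_adjugate.matrix_mulVec continuous_const)

lemma measurable_mix (γ : ℝ) (p₀ : Fin K → ℝ) : Measurable (mix γ p₀) := by
  unfold mix
  fun_prop

lemma measurable_correctedEst (ε σ β γ : ℝ) (p₀ : Fin K → ℝ) (c b : Fin K) :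
    Measurable fun z : (Fin K → ℝ) × ℝ => correctedEst ε σ β φ (mix γ p₀ z.1) c z.2 b := by
  have hm : Measurable fun z : (Fin K → ℝ) × ℝ => mix γ p₀ z.1 :=
    (measurable_mix γ p₀).comp measurable_fst
  have hl : Measurable fun z : (Fin K → ℝ) × ℝ => lossEst φ (mix γ p₀ z.1) c z.2 b :=
    ((measurable_invCovForm φ b c).comp hm).mul measurable_snd
  unfold correctedEst
  refine Measurable.sub ?_ ?_
  · exact Measurable.ite (measurableSet_le hl.abs measurable_const) hl measurable_const
  · exact (((measurable_invCovForm φ b b).comp hm).pow_const _).const_mul _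

lemma measurable_stableRegret (ε σ β γ : ℝ) (p₀ : Fin K → ℝ) (a c : Fin K) :
    Measurable fun z : (Fin K → ℝ) × ℝ =>
      stableRegret ε σ β φ (mix γ p₀ z.1) z.1 a c z.2 := by
  have h := fun b => measurable_correctedEst φ ε σ β γ p₀ c b
  have hq : ∀ b, Measurable fun z : (Fin K → ℝ) × ℝ => z.1 b := fun b =>
    (measurable_pi_apply b).comp measurable_fst
  unfold stableRegret
  refine ((Finset.measurable_sum _ fun b _ => (hq b).mul (h b)).sub (h a)).sub
    (Finset.measurable_sum _ fun b _ => ?_)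
  exact ((hq b).mul ((h b).pow_const 2)).div_const _

variable {φ}

lemma abs_stableRegret_le {ε σ β : ℝ} {p q : Fin K → ℝ} (hβ : 0 < β)
    (hq : q ∈ stdSimplex ℝ (Fin K)) (hB0 : ∀ b, 0 ≤ bonus ε σ (β / 2) φ p b)
    (hB : ∀ b, bonus ε σ (β / 2) φ p b ≤ β / 2) (a c : Fin K) (x : ℝ) :
    |stableRegret ε σ β φ p q a c x| ≤ 3 * β := by
  have h := abs_correctedEst_le hβ.le hB0 hB c x
  have hconst : ∑ b, q b * β = β := by rw [← Finset.sum_mul, hq.2, one_mul]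
  have h1 : |∑ b, q b * correctedEst ε σ β φ p c x b| ≤ β := by
    refine (Finset.abs_sum_le_sum_abs _ _).trans (le_trans (Finset.sum_le_sum fun b _ => ?_)
      hconst.le)
    rw [abs_mul, abs_of_nonneg (hq.1 b)]
    exact mul_le_mul_of_nonneg_left (h b) (hq.1 b)
  have h2 : |∑ b, q b * correctedEst ε σ β φ p c x b ^ 2 / β| ≤ β := by
    refine (Finset.abs_sum_le_sum_abs _ _).trans (le_trans (Finset.sum_le_sum fun b _ => ?_)
      hconst.le)
    rw [mul_div_assoc, abs_mul, abs_of_nonneg (hq.1 b)]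
    refine mul_le_mul_of_nonneg_left ?_ (hq.1 b)
    rw [abs_of_nonneg (by positivity), div_le_iff₀ hβ, ← sq, ← sq_abs]
    exact pow_le_pow_left₀ (abs_nonneg _) (h b) 2
  have h3 := h a
  rw [abs_le] at h1 h2 h3 ⊢
  unfold stableRegret
  constructor <;> linarith

end Measurability

/-! ### Regret over all rounds. -/

section Regret

variable {Ω : Type*} [mΩ : MeasurableSpace Ω] {K d T : ℕ} {ε σ : ℝ} {μ : Measure Ω}
  {𝒢 : Filtration ℕ mΩ} {φ : Fin K → Fin d → ℝ}
  {θ : ℕ → Ω → Fin d → ℝ} {ν : ℕ → Fin K → Ω → Measure ℝ} {ℓ : ℕ → Fin K → Ω → ℝ}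
  {p : ℕ → Ω → Fin K → ℝ} {arm : ℕ → Ω → Fin K}

lemma IsHeavyTailed.lintegral_enorm_le (hν : IsHeavyTailed T ε σ ν) (hε : 1 ≤ ε) (hσ : 0 < σ)
    (h : IsAdversarialInteraction μ 𝒢 T φ θ ν ℓ p arm) {t : ℕ} (ht : t < T) (b : Fin K) (ω : Ω) :
    ∫⁻ x, ‖x‖ₑ ∂(ν t b ω) ≤ ENNReal.ofReal (2 * σ ^ (1 / ε)) := by
  have := h.law_prob t ht b ω
  rw [← ofReal_integral_norm_eq_lintegral_enorm (h.law_integrable t ht b ω)]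
  exact ENNReal.ofReal_le_ofReal (integral_abs_le_of_moment hε hσ (hν t ht b ω))

variable [IsProbabilityMeasure μ]

/-- The regret of one round, computed by conditioning on what precedes it. -/
lemma IsAdversarialInteraction.integral_regret
    (h : IsAdversarialInteraction μ 𝒢 T φ θ ν ℓ p arm) (hν : IsHeavyTailed T ε σ ν) (hε : 1 ≤ ε)
    (hσ : 0 < σ) {t : ℕ} (ht : t < T) (hp : Measurable[𝒢 t] (p t)) (a : Fin K) :
    Integrable (fun ω => ℓ t (arm t ω) ω - ℓ t a ω) μ ∧
      Integrable (fun ω => ∑ c, max (p t ω c) 0 * (φ c ⬝ᵥ θ t ω - φ a ⬝ᵥ θ t ω)) μ ∧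
      ∫ ω, (ℓ t (arm t ω) ω - ℓ t a ω) ∂μ =
        ∫ ω, ∑ c, max (p t ω c) 0 * (φ c ⬝ᵥ θ t ω - φ a ⬝ᵥ θ t ω) ∂μ := by
  have hF : ∀ _ : Fin K, Measurable[(𝒢 t).prod inferInstance] fun z : Ω × ℝ => z.2 := fun _ =>
    @measurable_snd Ω ℝ (𝒢 t) _
  obtain ⟨h1, h2, h3⟩ := h.integral_round ht hp id hF ENNReal.ofReal_ne_top
    fun c ω => hν.lintegral_enorm_le hε hσ h ht c ω
  obtain ⟨k1, k2, k3⟩ := h.integral_round ht hp (fun _ => a) hF ENNReal.ofReal_ne_top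
    fun c ω => hν.lintegral_enorm_le hε hσ h ht a ω
  simp only [id, h.law_mean t ht] at h1 h2 h3 k1 k2 k3
  simp only [mul_sub, Finset.sum_sub_distrib]
  exact ⟨h1.sub k1, h2.sub k2, by rw [integral_sub h1 k1, integral_sub h2 k2, h3, k3]⟩

/-- Obtained by testing the round identity on the constant 1. It replaces membership of p in the
simplex, which is not available pointwise when the exploration rate exceeds 1. -/
lemma IsAdversarialInteraction.integral_sum_max_eq_one
    (h : IsAdversarialInteraction μ 𝒢 T φ θ ν ℓ p arm) {t : ℕ} (ht : t < T)
    (hp : Measurable[𝒢 t] (p t)) :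
    Integrable (fun ω => ∑ c, max (p t ω c) 0) μ ∧ ∫ ω, ∑ c, max (p t ω c) 0 ∂μ = 1 := by
  have := h.law_prob t ht
  obtain ⟨-, h2, h3⟩ := h.integral_round ht hp id (F := fun _ _ => 1)
    (fun _ => @measurable_const ℝ (Ω × ℝ) _ ((𝒢 t).prod inferInstance) 1) ENNReal.one_ne_top
    fun c ω => by simp
  simp only [integral_const, probReal_univ, smul_eq_mul, mul_one] at h2 h3
  exact ⟨h2, h3.symm⟩

lemma IsAdversarialInteraction.pseudoRegret_le
    (h : IsAdversarialInteraction μ 𝒢 T φ θ ν ℓ p arm) (hν : IsHeavyTailed T ε σ ν) (hε : 1 ≤ ε)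
    (hσ : 0 < σ) (hp : ∀ t < T, Measurable[𝒢 t] (p t)) [Nonempty (Fin K)] {R : ℝ}
    (hR : ∀ a, ∑ t ∈ Finset.range T,
      ∫ ω, ∑ c, max (p t ω c) 0 * (φ c ⬝ᵥ θ t ω - φ a ⬝ᵥ θ t ω) ∂μ ≤ R) :
    pseudoRegret μ T ℓ arm ≤ R := by
  refine ciSup_le fun a => le_trans (le_of_eq ?_) (hR a)
  have key := fun t (ht : t ∈ Finset.range T) =>
    h.integral_regret hν hε hσ (Finset.mem_range.1 ht) (hp t (Finset.mem_range.1 ht)) a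
  simp only [← Finset.sum_sub_distrib]
  rw [integral_finsetSum _ fun t ht => (key t ht).1]
  exact Finset.sum_congr rfl fun t ht => (key t ht).2.2

/-- The trivial bound on the regret. -/
lemma IsAdversarialInteraction.pseudoRegret_le_trivial
    (h : IsAdversarialInteraction μ 𝒢 T φ θ ν ℓ p arm) (hν : IsHeavyTailed T ε σ ν) (hε : 1 ≤ ε)
    (hσ : 0 < σ) (hp : ∀ t < T, Measurable[𝒢 t] (p t)) [Nonempty (Fin K)] :
    pseudoRegret μ T ℓ arm ≤ 4 * (σ ^ (1 / ε) * T) := by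
  refine h.pseudoRegret_le hν hε hσ hp fun a => ?_
  have hterm : ∀ t ∈ Finset.range T,
      ∫ ω, ∑ c, max (p t ω c) 0 * (φ c ⬝ᵥ θ t ω - φ a ⬝ᵥ θ t ω) ∂μ ≤ 4 * σ ^ (1 / ε) := by
    intro t ht
    replace ht := Finset.mem_range.1 ht
    obtain ⟨hi, h1⟩ := h.integral_sum_max_eq_one ht (hp t ht)
    calc _ ≤ ∫ ω, (∑ c, max (p t ω c) 0) * (4 * σ ^ (1 / ε)) ∂μ := by
          refine integral_mono (h.integral_regret hν hε hσ ht (hp t ht) a).2.1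
            (hi.mul_const _) fun ω => ?_
          simp only [Finset.sum_mul]
          refine Finset.sum_le_sum fun c _ => mul_le_mul_of_nonneg_left ?_ (le_max_right _ _)
          have hm : ∀ b, |φ b ⬝ᵥ θ t ω| ≤ 2 * σ ^ (1 / ε) := fun b => by
            have := h.law_prob t ht b ω
            rw [← h.law_mean t ht]
            exact abs_integral_le_of_moment hε hσ (hν t ht b ω)
          linarith [(abs_le.1 (hm c)).2, (abs_le.1 (hm a)).1]
      _ = 4 * σ ^ (1 / ε) := by rw [integral_mul_const, h1, one_mul]
  refine (Finset.sum_le_sum hterm).trans (le_of_eq ?_)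
  simp
  ring

variable {p₀ : Fin K → ℝ} {q : ℕ → Ω → Fin K → ℝ}

/-- The regret bound for horizons long enough that the exploration rate is at most `1 / 2`. -/
lemma IsFTRLRun.pseudoRegret_le (hq : IsFTRLRun 𝒢 T ε σ φ p₀ ℓ arm q)
    (h : IsAdversarialInteraction μ 𝒢 T φ θ ν ℓ
      (fun t ω => mix (explRate K d T ε σ) p₀ (q t ω)) arm)
    (hν : IsHeavyTailed T ε σ ν) (hp₀ : IsGOptimalDesign φ p₀) (hε1 : 1 < ε) (hε2 : ε ≤ 2)
    (hσ : 0 < σ) (hd : 0 < d) (hT : 0 < T) (hK : 0 < Real.log K)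
    (hγ : explRate K d T ε σ ≤ 1 / 2) [Nonempty (Fin K)] :
    pseudoRegret μ T ℓ arm ≤ 17 * (invRate K d T ε σ * Real.log K)
      + 4 * (explRate K d T ε σ * σ ^ (1 / ε) * T) := by
  have hε : 0 < ε := by linarith
  have hT' : (0 : ℝ) < T := by exact_mod_cast hT
  have hβ := invRate_pos (ε := ε) hσ hd hT hK
  have hγ0 := explRate_pos (ε := ε) hσ hd hT hK
  have hγ1 : explRate K d T ε σ ≤ 1 := by linarith
  have hpm : ∀ t < T, Measurable[𝒢 t] fun ω => mix (explRate K d T ε σ) p₀ (q t ω) :=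
    fun t ht => (measurable_mix _ _).comp (hq.meas t ht)
  have hqs : ∀ t < T, ∀ ω, q t ω ∈ stdSimplex ℝ (Fin K) := fun t ht ω => (hq.argmin t ht ω).1
  have hps := fun t ht ω => mix_mem_stdSimplex hγ0.le hγ1 hp₀.mem (hqs t ht ω)
  have hS := fun t ht ω =>
    isUnit_det_covMatrix_mix hγ0 hγ1 (hqs t ht ω).1 hp₀.mem.1 hp₀.nonsing
  have hB := fun t ht ω => bonus_le_clipLevel hσ hd hT hK hε hγ1 hp₀ (hqs t ht ω)
  have hbonus := fun t ht ω => sum_mul_bonus_le hσ hd hT hK hε1 hε2 hγ hp₀ (hqs t ht ω)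
  have hftrl := fun ω => ftrl_regret_le hβ T (fun t b => correctedEst ε σ (invRate K d T ε σ) φ
      (mix (explRate K d T ε σ) p₀ (q t ω)) (arm t ω) (ℓ t (arm t ω) ω) b) (fun t => q t ω)
  have hargmin := hq.argmin
  set β := invRate K d T ε σ
  set γ := explRate K d T ε σ
  have hB0 : ∀ t < T, ∀ ω b, 0 ≤ bonus ε σ (β / 2) φ (mix γ p₀ (q t ω)) b := fun t ht ω b =>
    bonus_nonneg hσ.le (by positivity) b
      (invCovForm_self_nonneg (hps t ht ω).1 (hS t ht ω) b)
  refine h.pseudoRegret_le hν hε1.le hσ hpm fun a => ?_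
  set F : ℕ → Fin K → Ω × ℝ → ℝ := fun t c z =>
    stableRegret ε σ β φ (mix γ p₀ (q t z.1)) (q t z.1) a c z.2 with hFdef
  have hround := fun t (ht : t < T) => h.integral_round ht (hpm t ht) id (F := F t)
    (fun c => by
      have h2 : Measurable[(𝒢 t).prod inferInstance] fun z : Ω × ℝ => (q t z.1, z.2) :=
        ((hq.meas t ht).comp (@measurable_fst Ω ℝ (𝒢 t) _)).prodMk (@measurable_snd Ω ℝ (𝒢 t) _)
      exact (measurable_stableRegret φ ε σ β γ p₀ a c).comp h2)
    (C := ENNReal.ofReal (3 * β)) ENNReal.ofReal_ne_top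
    (fun c ω => by
      have := h.law_prob t ht c ω
      calc ∫⁻ x, ‖F t c (ω, x)‖ₑ ∂(ν t c ω) ≤ ∫⁻ _, ENNReal.ofReal (3 * β) ∂(ν t c ω) := by
            refine lintegral_mono fun x => ?_
            rw [← ofReal_norm]
            exact ENNReal.ofReal_le_ofReal
              (abs_stableRegret_le hβ (hqs t ht ω) (hB0 t ht ω) (hB t ht ω) a c x)
        _ = ENNReal.ofReal (3 * β) := by simp)
  simp only [id] at hround
  -- Per-round cost of exploration and bonuses; 16 is the four bonus averages times the 4 of
  -- `sum_mul_bonus_le`.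
  set R : ℝ := 4 * γ * σ ^ (1 / ε) + 16 * (β * Real.log K) / T with hRdef
  have hterm : ∀ t ∈ Finset.range T,
      ∫ ω, ∑ c, max (mix γ p₀ (q t ω) c) 0 * (φ c ⬝ᵥ θ t ω - φ a ⬝ᵥ θ t ω) ∂μ ≤
        (∫ ω, F t (arm t ω) (ω, ℓ t (arm t ω) ω) ∂μ) + R := by
    intro t ht
    replace ht := Finset.mem_range.1 ht
    have hR : ∫ ω, (∑ c, max (mix γ p₀ (q t ω) c) 0 * ∫ x, F t c (ω, x) ∂(ν t c ω)) + R ∂μ =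
        (∫ ω, F t (arm t ω) (ω, ℓ t (arm t ω) ω) ∂μ) + R := by
      rw [integral_add (hround t ht).2.1 (integrable_const _), integral_const, probReal_univ,
        one_smul]
      congr 1
      exact (hround t ht).2.2.symm
    rw [← hR]
    refine integral_mono (h.integral_regret hν hε1.le hσ ht (hpm t ht) a).2.1
      ((hround t ht).2.1.add (integrable_const _)) fun ω => ?_
    have := fun c => h.law_prob t ht c ω
    have hmax : ∀ c, max (mix γ p₀ (q t ω) c) 0 = mix γ p₀ (q t ω) c := fun c =>
      max_eq_left ((hps t ht ω).1 c)
    simp only [hmax]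
    have hm : ∀ b, |φ b ⬝ᵥ θ t ω| ≤ 2 * σ ^ (1 / ε) := fun b => by
      rw [← h.law_mean t ht]
      exact abs_integral_le_of_moment hε1.le hσ (hν t ht b ω)
    have hint : ∀ c, Integrable (stableRegret ε σ β φ (mix γ p₀ (q t ω)) (q t ω) a c)
        (ν t c ω) := fun c => by
      refine Integrable.of_bound (C := 3 * β) ?_ (Filter.Eventually.of_forall fun x =>
        abs_stableRegret_le hβ (hqs t ht ω) (hB0 t ht ω) (hB t ht ω) a c x)
      exact ((measurable_stableRegret φ ε σ β γ p₀ a c).comp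
        (measurable_const.prodMk measurable_id)).aestronglyMeasurable
    have hone := regret_le_integral_stableRegret hε1.le hε2 hσ hβ (hqs t ht ω).1 (hps t ht ω)
      (hS t ht ω) (hB t ht ω) (fun c => hν t ht c ω) (fun c => h.law_mean t ht c ω) a hint
    have hbon : 4 * ∑ b, q t ω b * bonus ε σ (β / 2) φ (mix γ p₀ (q t ω)) b ≤
        16 * (β * Real.log K) / T := by
      rw [le_div_iff₀ hT']
      linarith [hbonus t ht ω]
    have hexpl : ∑ c, mix γ p₀ (q t ω) c * (φ c ⬝ᵥ θ t ω - φ a ⬝ᵥ θ t ω) ≤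
        ((∑ b, q t ω b * (φ b ⬝ᵥ θ t ω)) - φ a ⬝ᵥ θ t ω) + 4 * γ * σ ^ (1 / ε) := by
      have e1 : ∑ c, mix γ p₀ (q t ω) c * (φ c ⬝ᵥ θ t ω - φ a ⬝ᵥ θ t ω) =
          (∑ b, q t ω b * (φ b ⬝ᵥ θ t ω)) - φ a ⬝ᵥ θ t ω
            + γ * ((∑ c, p₀ c * (φ c ⬝ᵥ θ t ω)) - ∑ c, q t ω c * (φ c ⬝ᵥ θ t ω)) := by
        simp only [mul_sub, Finset.sum_sub_distrib, ← Finset.sum_mul, (hps t ht ω).2, one_mul]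
        simp only [mix, Finset.mul_sum, add_mul, Finset.sum_add_distrib, sub_mul, one_mul,
          Finset.sum_sub_distrib, mul_assoc]
        ring
      have e2 : ∀ w ∈ stdSimplex ℝ (Fin K), |∑ c, w c * (φ c ⬝ᵥ θ t ω)| ≤ 2 * σ ^ (1 / ε) := by
        intro w hw
        have e3 : ∑ c, w c * (2 * σ ^ (1 / ε)) = 2 * σ ^ (1 / ε) := by
          rw [← Finset.sum_mul, hw.2, one_mul]
        refine (Finset.abs_sum_le_sum_abs _ _).trans (le_trans (Finset.sum_le_sum fun c _ => ?_)
          e3.le)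
        rw [abs_mul, abs_of_nonneg (hw.1 c)]
        exact mul_le_mul_of_nonneg_left (hm c) (hw.1 c)
      have e4 := (abs_le.1 (e2 _ hp₀.mem)).2
      have e5 := (abs_le.1 (e2 _ (hqs t ht ω))).1
      rw [e1]
      have : γ * ((∑ c, p₀ c * (φ c ⬝ᵥ θ t ω)) - ∑ c, q t ω c * (φ c ⬝ᵥ θ t ω)) ≤
          γ * (4 * σ ^ (1 / ε)) := mul_le_mul_of_nonneg_left (by linarith) hγ0.le
      linarith
    simp only [hFdef, hRdef]
    linarith
  have hpath : ∑ t ∈ Finset.range T, ∫ ω, F t (arm t ω) (ω, ℓ t (arm t ω) ω) ∂μ ≤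
      β * Real.log K := by
    have hi : ∀ t ∈ Finset.range T,
        Integrable (fun ω => F t (arm t ω) (ω, ℓ t (arm t ω) ω)) μ := fun t ht =>
      (hround t (Finset.mem_range.1 ht)).1
    rw [← integral_finsetSum _ hi]
    -- The FTRL bound holds on every path, so adaptivity of the adversary plays no role here.
    calc _ ≤ ∫ _, β * Real.log K ∂μ :=
          integral_mono (integrable_finsetSum _ hi) (integrable_const _) fun ω =>
            hftrl ω (fun t ht b => abs_correctedEst_le hβ.le (hB0 t ht ω) (hB t ht ω) _ _ b)
              (fun t ht => hargmin t ht ω) a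
      _ = β * Real.log K := by simp
  refine (Finset.sum_le_sum hterm).trans ?_
  rw [Finset.sum_add_distrib, Finset.sum_const, Finset.card_range, nsmul_eq_mul]
  have hTR : T * R = 4 * (γ * σ ^ (1 / ε) * T) + 16 * (β * Real.log K) := by
    rw [hRdef]
    field_simp
  linarith

end Regret

end HeavyTailedLinearBandit

end

/-! ### The regret bound. -/

open HeavyTailedLinearBandit in
theorem theorem2 :
    ∃ C : ℝ, 0 < C ∧
      ∀ (K d T : ℕ) (ε σ : ℝ), 1 < ε → ε ≤ 2 → 0 < σ →
      ∀ φ : Fin K → Fin d → ℝ, Submodule.span ℝ (Set.range φ) = ⊤ →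
      ∀ p₀ : Fin K → ℝ, IsGOptimalDesign φ p₀ →
      ∀ (Ω : Type*) [mΩ : MeasurableSpace Ω] (μ : Measure Ω) [IsProbabilityMeasure μ]
        (𝒢 : Filtration ℕ mΩ) (θ : ℕ → Ω → Fin d → ℝ) (ν : ℕ → Fin K → Ω → Measure ℝ)
        (ℓ : ℕ → Fin K → Ω → ℝ) (arm : ℕ → Ω → Fin K) (q : ℕ → Ω → Fin K → ℝ),
        IsHeavyTailed T ε σ ν →
        IsAdversarialInteraction μ 𝒢 T φ θ ν ℓ
          (fun t ω => mix (explRate K d T ε σ) p₀ (q t ω)) arm →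
        IsFTRLRun 𝒢 T ε σ φ p₀ ℓ arm q →
        pseudoRegret μ T ℓ arm ≤
          C * (σ ^ (1 / ε) * Real.log K ^ (1 - 1 / ε) * (d : ℝ) ^ (1 / 2 : ℝ)
            * (T : ℝ) ^ (1 / ε)) := by
  -- 33 = 17 + 4 · 4 for small exploration rate; the trivial bound needs only 4 · 8 = 32.
  refine ⟨33, by norm_num, ?_⟩
  intro K d T ε σ hε1 hε2 hσ φ _ p₀ hp₀ Ω mΩ μ _ 𝒢 θ ν ℓ arm q hν h hq
  have hε : 0 < ε := by linarith
  have hpm : ∀ t < T, Measurable[𝒢 t] fun ω => mix (explRate K d T ε σ) p₀ (q t ω) :=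
    fun t ht => (measurable_mix _ _).comp (hq.meas t ht)
  have hKne : K ≠ 0 := by
    rintro rfl
    simpa using hp₀.mem.2
  have : Nonempty (Fin K) := ⟨⟨0, Nat.pos_of_ne_zero hKne⟩⟩
  have hlog : 0 ≤ Real.log K := Real.log_natCast_nonneg K
  have hRHS : 0 ≤ 33 * (σ ^ (1 / ε) * Real.log K ^ (1 - 1 / ε) * (d : ℝ) ^ (1 / 2 : ℝ)
      * (T : ℝ) ^ (1 / ε)) := by positivity
  rcases Nat.eq_zero_or_pos T with rfl | hT
  · refine le_trans (ciSup_le fun a => ?_) hRHS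
    simp
  rcases Nat.eq_zero_or_pos d with rfl | hd
  -- In dimension 0 every mean loss is an empty inner product, so the regret vanishes whatever the
  -- junk values of the parameters.
  · refine (h.pseudoRegret_le hν hε1.le hσ hpm (R := 0) fun a => ?_).trans hRHS
    simp
  rcases hlog.eq_or_lt with hK | hK
  · have hK1 : K = 1 := by
      rcases Real.log_eq_zero.1 hK.symm with h0 | h0 | h0
      · exact absurd (by exact_mod_cast h0) hKne
      · exact_mod_cast h0
      · linarith [Nat.cast_nonneg (α := ℝ) K]
    subst hK1
    refine le_trans (ciSup_le fun a => ?_) hRHS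
    simp [Subsingleton.elim (arm _ _) a]
  rcases le_or_gt (explRate K d T ε σ) (1 / 2) with hγ | hγ
  · have h1 := hq.pseudoRegret_le h hν hp₀ hε1 hε2 hσ hd hT hK hγ
    have h2 := explRate_mul_le hσ hd hT hK hε1 hε2 hγ
    rw [← rate_eq_invRate_mul_log hσ hd hT hK hε] at h1
    linarith
  · have h1 := h.pseudoRegret_le_trivial hν hε1.le hσ hpm
    have h2 := mul_le_rate_of_explRate_gt hσ hd hT hK hε1 hε2 hγ
    linarith
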